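/- **Setting.** Let $n,m,p\ge 1$ and let $a_{i,l}\in\mathbb R^n$ ($1\le i\le m$, $1\le l\le p$) be i.i.d. random vectors that are centred ($\mathbb E a_{i,l}=0$), isotropic ($\mathbb E a_{i,l}a_{i,l}^\top=I_n$) and sub-Gaussian with $\|a_{i,l}\|_{\psi_2}\le K$, where $\|X\|_{\psi_2}=\sup_{q\ge1}q^{-1/2}(\mathbb E|X|^q)^{1/q}$ for a random variable and $\|a\|_{\psi_2}=\sup_{\|u\|_2=1}\|\langle a,u\rangle\|_{\psi_2}$ for a random vector. Let $A_l\in\mathbb R^{m\times n}$ be the matrix with rows $a_{1,l}^\top,\dots,a_{m,l}^\top$. Fix a signal $x\in\mathbb R^n$ and gains $d\in\mathbb R^m$ with positive entries, and put $$f(\xi,\gamma)=\frac1{2mp}\sum_{l=1}^p\|\mathrm{diag}(\gamma)A_l\xi-\mathrm{diag}(d)A_lx\|_2^2,\qquad (\xi,\gamma)\in\mathbb R^n\times\mathbb R^m,$$ $$x^\star=\tfrac{\|d\|_1}{m}x,\qquad d^\star=\tfrac{m}{\|d\|_1}d,\qquad \Delta(\xi,\gamma)=\|\xi-x^\star\|_2^2+\tfrac{\|x^\star\|_2^2}{m}\|\gamma-d^\star\|_2^2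 .$$ For $\rho\in[0,1)$ let $\mathcal C_\rho=\{\gamma\in\mathbb R^m:\ \sum_i(\gamma_i-1)=0,\ \max_i|\gamma_i-1|\le\rho\}$, and for $\kappa\ge0$ let $\mathcal D_{\kappa,\rho}=\{(\xi,\gamma)\in\mathbb R^n\times\mathcal C_\rho:\ \Delta(\xi,\gamma)\le\kappa^2\|x^\star\|_2^2\}$. Assume $d^\star\in\mathcal C_\rho$. Let $\nabla^\perp f=\big(\nabla_\xi f,\ (I_m-\tfrac1m 1_m1_m^\top)\nabla_\gamma f\big)\in\mathbb R^n\times\mathbb R^m$ be the projected gradient. **Proposition 2 (Regularity condition in $\mathcal D_{\kappa,\rho}$).** For every $K\geq 0$ there are constants $C_0,C,c>0$, depending only on $K$, such that the following holds in the above setting. Let $\delta\in(0,1)$, $t\ge1$, $0\le\rho<\frac{1-2\delta}{9}$ and $\kappa\ge0$, and suppose $$n\ge C_0\,t\log(mp),\qquad p\ge C_0\,\delta^{-2}\log m,\qquad \sqrt m\,p\ge C_0\,\delta^{-2}(n+m)\log\tfrac n\delta .$$ Then, with probability exceeding $$1-C\big[m e^{-c\delta^2p}+e^{-c\delta^2\sqrt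 m\,p}+e^{-c\delta^2mp}+(mp)^{-t}\big],$$ we have simultaneously for all $(\xi,\gamma)\in\mathcal D_{\kappa,\rho}$ $$\Big\langle\nabla^\perp f(\xi,\gamma),\ (\xi-x^\star,\gamma-d^\star)\Big\rangle\ \ge\ \tfrac\eta2\,\Delta(\xi,\gamma)\qquad\text{and}\qquad \|\nabla^\perp f(\xi,\gamma)\|_2^2\ \le\ L^2\,\Delta(\xi,\gamma),$$ where $\eta=2(1-9\rho-2\delta)$ and $L=4\sqrt2\,[1+\rho+(1+\kappa)\|x^\star\|_2]$. -/

import Mathlib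

open MeasureTheory ProbabilityTheory
open scoped ENNReal NNReal Matrix Gradient

namespace BlindCalibration

noncomputable section

/-! ### Sub-Gaussian random vectors -/

/-- The sub-Gaussian norm `‖X‖_ψ₂ = sup_{q ≥ 1} q^{-1/2} (E |X|^q)^{1/q}` of a real random
variable, with value `∞` if `X` is not sub-Gaussian. -/
def psi2Norm {Ω : Type*} [MeasurableSpace Ω] (X : Ω → ℝ) (μ : Measure Ω) : ℝ≥0∞ :=
  ⨆ (q : ℝ) (_ : 1 ≤ q), ENNReal.ofReal (q ^ (-(1 / 2) : ℝ)) * eLpNorm X (ENNReal.ofReal q) μ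

/-- The sub-Gaussian norm of a random vector: the supremum of the sub-Gaussian norms of its
one-dimensional marginals along unit vectors. -/
def psi2NormVec {n : ℕ} {Ω : Type*} [MeasurableSpace Ω] (Y : Ω → EuclideanSpace ℝ (Fin n))
    (μ : Measure Ω) : ℝ≥0∞ :=
  ⨆ (u : EuclideanSpace ℝ (Fin n)) (_ : ‖u‖ = 1), psi2Norm (fun ω => inner ℝ (Y ω) u) μ

/-- The `m p` sensing vectors `a i l` are i.i.d. centred isotropic sub-Gaussian random vectors
of `ℝⁿ` with sub-Gaussian norm at most `K`. -/
structure IsSensingEnsemble {n m p : ℕ} {Ω : Type*} [MeasurableSpace Ω]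
    (a : Fin m → Fin p → Ω → EuclideanSpace ℝ (Fin n)) (μ : Measure Ω) (K : ℝ≥0) : Prop where
  measurable : ∀ i l, Measurable (a i l)
  indep : iIndepFun (fun il : Fin m × Fin p => a il.1 il.2) μ
  identDistrib : ∀ i l i' l', IdentDistrib (a i l) (a i' l') μ μ
  centred : ∀ i l j, ∫ ω, a i l ω j ∂μ = 0
  isotropic : ∀ i l j k, ∫ ω, a i l ω j * a i l ω k ∂μ = if j = k then 1 else 0
  subGaussian : ∀ i l, psi2NormVec (a i l) μ ≤ K

/-- The sensing matrices `A_l ∈ ℝ^{m × n}`, whose rows are the sensing vectors `a i l`. -/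
def sensingMatrix {n m p : ℕ} (a : Fin m → Fin p → EuclideanSpace ℝ (Fin n)) (l : Fin p) :
    Matrix (Fin m) (Fin n) ℝ :=
  Matrix.of fun i j => a i l j

/-! ### The objective function and its projected gradient -/

/-- The objective `f(ξ, γ) = 1/(2mp) ∑_l ‖diag(γ) A_l ξ - diag(d) A_l x‖²`. -/
def objective {n m p : ℕ} (A : Fin p → Matrix (Fin m) (Fin n) ℝ)
    (x : EuclideanSpace ℝ (Fin n)) (d : EuclideanSpace ℝ (Fin m))
    (ξ : EuclideanSpace ℝ (Fin n)) (γ : EuclideanSpace ℝ (Fin m)) : ℝ :=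
  1 / (2 * (m : ℝ) * (p : ℝ)) * ∑ l : Fin p,
    ‖WithLp.toLp 2 (Matrix.diagonal γ.ofLp *ᵥ (A l *ᵥ ξ.ofLp)
      - Matrix.diagonal d.ofLp *ᵥ (A l *ᵥ x.ofLp))‖ ^ 2

/-- The signal gradient `∇_ξ f`. -/
def gradSignal {n m p : ℕ} (A : Fin p → Matrix (Fin m) (Fin n) ℝ)
    (x : EuclideanSpace ℝ (Fin n)) (d : EuclideanSpace ℝ (Fin m))
    (ξ : EuclideanSpace ℝ (Fin n)) (γ : EuclideanSpace ℝ (Fin m)) : EuclideanSpace ℝ (Fin n) :=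
  gradient (fun ξ' => objective A x d ξ' γ) ξ

/-- The gain gradient `∇_γ f`. -/
def gradGain {n m p : ℕ} (A : Fin p → Matrix (Fin m) (Fin n) ℝ)
    (x : EuclideanSpace ℝ (Fin n)) (d : EuclideanSpace ℝ (Fin m))
    (ξ : EuclideanSpace ℝ (Fin n)) (γ : EuclideanSpace ℝ (Fin m)) : EuclideanSpace ℝ (Fin m) :=
  gradient (fun γ' => objective A x d ξ γ') γ

/-- The projection matrix `I - (1/m) 1 1ᵀ` onto the orthogonal complement of the all-ones
vector. -/
def projOnesPerp (m : ℕ) : Matrix (Fin m) (Fin m) ℝ :=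
  1 - (1 / (m : ℝ)) • Matrix.of fun _ _ => (1 : ℝ)

/-- The projected gradient `∇^⊥ f`: the vector of `ℝⁿ × ℝᵐ` (with the Euclidean structure) that
stacks `∇_ξ f` and `(I - (1/m) 1 1ᵀ) ∇_γ f`. -/
def projGrad {n m p : ℕ} (A : Fin p → Matrix (Fin m) (Fin n) ℝ)
    (x : EuclideanSpace ℝ (Fin n)) (d : EuclideanSpace ℝ (Fin m))
    (ξ : EuclideanSpace ℝ (Fin n)) (γ : EuclideanSpace ℝ (Fin m)) :
    WithLp 2 (EuclideanSpace ℝ (Fin n) × EuclideanSpace ℝ (Fin m)) :=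
  WithLp.toLp 2 (gradSignal A x d ξ γ,
    WithLp.toLp 2 (projOnesPerp m *ᵥ (gradGain A x d ξ γ).ofLp))

/-! ### The minimiser, the distance and the neighbourhood -/

/-- The `ℓ¹` norm of the gain vector. -/
def l1Norm {m : ℕ} (d : EuclideanSpace ℝ (Fin m)) : ℝ := ∑ i, |d i|

/-- The rescaled signal `x⋆ = (‖d‖₁ / m) x`. -/
def xStar {n m : ℕ} (x : EuclideanSpace ℝ (Fin n)) (d : EuclideanSpace ℝ (Fin m)) :
    EuclideanSpace ℝ (Fin n) :=
  (l1Norm d / (m : ℝ)) • x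

/-- The rescaled gains `d⋆ = (m / ‖d‖₁) d`. -/
def dStar {m : ℕ} (d : EuclideanSpace ℝ (Fin m)) : EuclideanSpace ℝ (Fin m) :=
  ((m : ℝ) / l1Norm d) • d

/-- The set `C_ρ = 1 + (1^⊥ ∩ ρ B_∞)`. -/
def gainSet (m : ℕ) (ρ : ℝ) : Set (EuclideanSpace ℝ (Fin m)) :=
  {γ | ∑ i, (γ i - 1) = 0 ∧ ∀ i, |γ i - 1| ≤ ρ}

/-- The distance `Δ(ξ, γ) = ‖ξ - x⋆‖² + (‖x⋆‖² / m) ‖γ - d⋆‖²`. -/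
def dist2 {n m : ℕ} (x : EuclideanSpace ℝ (Fin n)) (d : EuclideanSpace ℝ (Fin m))
    (ξ : EuclideanSpace ℝ (Fin n)) (γ : EuclideanSpace ℝ (Fin m)) : ℝ :=
  ‖ξ - xStar x d‖ ^ 2 + ‖xStar x d‖ ^ 2 / (m : ℝ) * ‖γ - dStar d‖ ^ 2

/-- The neighbourhood `D_{κ,ρ} = {(ξ, γ) ∈ ℝⁿ × C_ρ : Δ(ξ, γ) ≤ κ² ‖x⋆‖²}`. -/
def nbhd {n m : ℕ} (x : EuclideanSpace ℝ (Fin n)) (d : EuclideanSpace ℝ (Fin m)) (κ ρ : ℝ) :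
    Set (EuclideanSpace ℝ (Fin n) × EuclideanSpace ℝ (Fin m)) :=
  {z | z.2 ∈ gainSet m ρ ∧ dist2 x d z.1 z.2 ≤ κ ^ 2 * ‖xStar x d‖ ^ 2}

/-- The bounded curvature condition at `(ξ, γ)` with constant `η`. -/
def BoundedCurvature {n m p : ℕ} (A : Fin p → Matrix (Fin m) (Fin n) ℝ)
    (x : EuclideanSpace ℝ (Fin n)) (d : EuclideanSpace ℝ (Fin m)) (η : ℝ)
    (ξ : EuclideanSpace ℝ (Fin n)) (γ : EuclideanSpace ℝ (Fin m)) : Prop :=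
  inner ℝ (projGrad A x d ξ γ) (WithLp.toLp 2 (ξ - xStar x d, γ - dStar d))
    ≥ η / 2 * dist2 x d ξ γ

/-- The Lipschitz gradient condition at `(ξ, γ)` with constant `L`. -/
def LipschitzGradient {n m p : ℕ} (A : Fin p → Matrix (Fin m) (Fin n) ℝ)
    (x : EuclideanSpace ℝ (Fin n)) (d : EuclideanSpace ℝ (Fin m)) (L : ℝ)
    (ξ : EuclideanSpace ℝ (Fin n)) (γ : EuclideanSpace ℝ (Fin m)) : Prop :=
  ‖projGrad A x d ξ γ‖ ^ 2 ≤ L ^ 2 * dist2 x d ξ γ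

end

end BlindCalibration

namespace BlindCalibration

/-! ### Sub-Gaussian variables and Bernstein's inequality -/

/-! Write `h = ξ - x⋆`, `β = γ - d⋆`, `H = ⟨a_{i,l}, h⟩`, `Y = ⟨a_{i,l}, x⋆⟩`. Since `d_i x = d⋆_i
x⋆`, each residual equals `γ_i H + β_i Y` (`residual_eq`). Both gain vectors lie in `C_ρ`, so `β`
sums to zero and the projection disappears from the curvature pairing, which becomes the average of
`(γ_i H + β_i Y)(γ_i H + β_i (Y + H))`. As `γ_i` is within `ρ` of 1, this is `H² + β_i² Y² + 2 β_i Y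
H` up to `O(ρ)`. The sums of the first two terms concentrate around `mp‖h‖²` and `p‖x⋆‖²‖β‖²`, that
is, `mp Δ` in total; the cross term has mean proportional to `∑ β_i = 0` (`curvature_sum_ge`). The
gradient bound follows from Cauchy-Schwarz and the same estimates (`norm_gradSignal_sq_le`,
`norm_gradGain_sq_le`).

All randomness is isolated in the four inequalities of `WellConditioned`. Products of sub-Gaussian
marginals are sub-exponential, so `bernstein` controls them in fixed directions, and 1/2-nets of
cardinality at most `5^dim` give uniformity (`measure_bilin_le`). The sample-size condition makes
the net cardinalities cost at most half of the exponent. -/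

lemma lintegral_even_pow_le_of_psi2Norm_le {Ω : Type*} [MeasurableSpace Ω] {μ : Measure Ω}
    {X : Ω → ℝ} {K : ℝ≥0} (hK : psi2Norm X μ ≤ K) {k : ℕ} (hk : 1 ≤ k) :
    ∫⁻ ω, ENNReal.ofReal ((X ω ^ 2) ^ k) ∂μ ≤ ENNReal.ofReal ((2 * k * (K : ℝ) ^ 2) ^ k) := by
  have hk' : (1 : ℝ) ≤ k := by exact_mod_cast hk
  have hq : (0 : ℝ) < 2 * k := by linarith
  have h1 : ENNReal.ofReal ((2 * k : ℝ) ^ (-(1 / 2) : ℝ)) *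
      eLpNorm X (ENNReal.ofReal (2 * k)) μ ≤ K :=
    (le_iSup₂ (f := fun (q : ℝ) (_ : 1 ≤ q) => ENNReal.ofReal (q ^ (-(1 / 2) : ℝ)) *
      eLpNorm X (ENNReal.ofReal q) μ) (2 * k : ℝ) (by linarith)).trans hK
  have h2 : eLpNorm X (ENNReal.ofReal (2 * k)) μ ≤ ENNReal.ofReal (√(2 * k) * K) := by
    have hpos : (0 : ℝ) < (2 * k : ℝ) ^ (-(1 / 2) : ℝ) := Real.rpow_pos_of_pos hq _
    rw [mul_comm, ← ENNReal.le_div_iff_mul_le (Or.inl (by simpa using hpos)) (Or.inl (by simp))]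
      at h1
    refine h1.trans (le_of_eq ?_)
    rw [← ENNReal.ofReal_coe_nnreal, ← ENNReal.ofReal_div_of_pos hpos, Real.rpow_neg hq.le,
      Real.sqrt_eq_rpow, div_inv_eq_mul, mul_comm]
  have h3 : ∫⁻ ω, ENNReal.ofReal ((X ω ^ 2) ^ k) ∂μ
      = eLpNorm X (ENNReal.ofReal (2 * k)) μ ^ (2 * k : ℝ) := by
    rw [eLpNorm_eq_lintegral_rpow_enorm_toReal (ENNReal.ofReal_pos.2 hq).ne' ENNReal.ofReal_ne_top,
      ENNReal.toReal_ofReal hq.le, ← ENNReal.rpow_mul, one_div_mul_cancel hq.ne', ENNReal.rpow_one]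
    refine lintegral_congr fun ω => ?_
    rw [Real.enorm_eq_ofReal_abs, ENNReal.ofReal_rpow_of_nonneg (abs_nonneg _) hq.le]
    congr 1
    rw [show (2 * k : ℝ) = ((2 * k : ℕ) : ℝ) by push_cast; ring, Real.rpow_natCast, pow_mul,
      sq_abs]
  rw [h3]
  refine (ENNReal.rpow_le_rpow h2 hq.le).trans (le_of_eq ?_)
  rw [ENNReal.ofReal_rpow_of_nonneg (by positivity) hq.le]
  congr 1
  rw [show (2 * k : ℝ) = ((2 * k : ℕ) : ℝ) by push_cast; ring, Real.rpow_natCast, pow_mul,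
    mul_pow, Real.sq_sqrt (by positivity)]

/-- Integrate the exponential series termwise. The even moments and `k^k / k! ≤ e^k ≤ 3^k` bound the
`k`-th term by `(6θK²)^k`; the constant 12 makes the ratio at most 1/2, and the geometric series
sums to 2. -/
lemma integral_exp_sq_le_two {Ω : Type*} [MeasurableSpace Ω] {μ : Measure Ω}
    [IsProbabilityMeasure μ] {X : Ω → ℝ} {K : ℝ≥0} (hX : Measurable X) (hK : psi2Norm X μ ≤ K)
    {θ : ℝ} (hθ : 0 ≤ θ) (hθK : 12 * θ * (K : ℝ) ^ 2 ≤ 1) :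
    Integrable (fun ω => Real.exp (θ * X ω ^ 2)) μ ∧
      ∫ ω, Real.exp (θ * X ω ^ 2) ∂μ ≤ 2 := by
  have hlint : ∫⁻ ω, ENNReal.ofReal (Real.exp (θ * X ω ^ 2)) ∂μ ≤ ENNReal.ofReal 2 := by
    have hser : ∀ ω, ENNReal.ofReal (Real.exp (θ * X ω ^ 2))
        = ∑' k : ℕ, ENNReal.ofReal (θ ^ k / k.factorial) * ENNReal.ofReal ((X ω ^ 2) ^ k) := by
      intro ω
      rw [Real.exp_eq_exp_ℝ, NormedSpace.exp_eq_tsum_div, ENNReal.ofReal_tsum_of_nonneg]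
      · refine tsum_congr fun k => ?_
        rw [← ENNReal.ofReal_mul (by positivity), mul_pow]
        congr 1
        ring
      · intro k; positivity
      · exact NormedSpace.expSeries_div_summable (𝔸 := ℝ) _
    simp_rw [hser]
    rw [lintegral_tsum (fun k => by fun_prop)]
    have hterm : ∀ k : ℕ, ∫⁻ ω, ENNReal.ofReal (θ ^ k / k.factorial) *
        ENNReal.ofReal ((X ω ^ 2) ^ k) ∂μ ≤ ENNReal.ofReal ((1 / 2) ^ k) := by
      intro k
      rcases Nat.eq_zero_or_pos k with rfl | hk
      · simp
      rw [lintegral_const_mul _ (by fun_prop)]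
      refine (mul_le_mul_right (lintegral_even_pow_le_of_psi2Norm_le hK hk) _).trans ?_
      rw [← ENNReal.ofReal_mul (by positivity)]
      refine ENNReal.ofReal_le_ofReal ?_
      have h1 : (k : ℝ) ^ k / k.factorial ≤ 3 ^ k := by
        refine (Real.pow_div_factorial_le_exp _ (by positivity) k).trans ?_
        rw [← mul_one (k : ℝ), Real.exp_nat_mul]
        exact pow_le_pow_left₀ (Real.exp_pos _).le
          (by linarith [Real.exp_one_lt_d9]) _
      calc θ ^ k / k.factorial * (2 * k * (K : ℝ) ^ 2) ^ k
          = (2 * θ * (K : ℝ) ^ 2) ^ k * ((k : ℝ) ^ k / k.factorial) := by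
            simp only [mul_pow]; ring
        _ ≤ (1 / 6) ^ k * 3 ^ k := by
            gcongr
            linarith
        _ = (1 / 2) ^ k := by rw [← mul_pow]; norm_num
    refine (ENNReal.tsum_le_tsum hterm).trans (le_of_eq ?_)
    rw [← ENNReal.ofReal_tsum_of_nonneg (fun k => by positivity) summable_geometric_two,
      tsum_geometric_two]
  have hint : Integrable (fun ω => Real.exp (θ * X ω ^ 2)) μ := by
    refine ⟨by fun_prop, ?_⟩
    rw [hasFiniteIntegral_iff_ofReal (ae_of_all _ fun _ => (Real.exp_pos _).le)]
    exact hlint.trans_lt ENNReal.ofReal_lt_top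
  refine ⟨hint, ?_⟩
  rw [← ofReal_integral_eq_lintegral_ofReal hint (ae_of_all _ fun _ => (Real.exp_pos _).le)]
    at hlint
  exact (ENNReal.ofReal_le_ofReal_iff (by norm_num)).1 hlint

lemma integral_exp_abs_mul_le_two {Ω : Type*} [MeasurableSpace Ω] {μ : Measure Ω}
    {X Y : Ω → ℝ} (hX : Measurable X) (hY : Measurable Y) {θ : ℝ} (hθ : 0 ≤ θ)
    (hXi : Integrable (fun ω => Real.exp (θ * X ω ^ 2)) μ)
    (hYi : Integrable (fun ω => Real.exp (θ * Y ω ^ 2)) μ)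
    (hX2 : ∫ ω, Real.exp (θ * X ω ^ 2) ∂μ ≤ 2) (hY2 : ∫ ω, Real.exp (θ * Y ω ^ 2) ∂μ ≤ 2) :
    Integrable (fun ω => Real.exp (θ * |X ω * Y ω|)) μ ∧
      ∫ ω, Real.exp (θ * |X ω * Y ω|) ∂μ ≤ 2 := by
  have hpt : ∀ ω, Real.exp (θ * |X ω * Y ω|)
      ≤ (Real.exp (θ * X ω ^ 2) + Real.exp (θ * Y ω ^ 2)) / 2 := by
    intro ω
    have h1 : |X ω * Y ω| ≤ (X ω ^ 2 + Y ω ^ 2) / 2 := by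
      rw [abs_le]
      constructor <;> nlinarith [sq_nonneg (X ω - Y ω), sq_nonneg (X ω + Y ω)]
    have h2 : Real.exp (θ * |X ω * Y ω|)
        ≤ Real.exp (θ * X ω ^ 2 / 2) * Real.exp (θ * Y ω ^ 2 / 2) := by
      rw [← Real.exp_add]
      exact Real.exp_le_exp.2 (by nlinarith)
    have h3 : ∀ z : ℝ, Real.exp z = Real.exp (z / 2) ^ 2 := fun z => by
      rw [← Real.exp_nat_mul]; congr 1; push_cast; ring
    rw [h3 (θ * X ω ^ 2), h3 (θ * Y ω ^ 2)]
    nlinarith [sq_nonneg (Real.exp (θ * X ω ^ 2 / 2) - Real.exp (θ * Y ω ^ 2 / 2))]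
  have hi : Integrable (fun ω => (Real.exp (θ * X ω ^ 2) + Real.exp (θ * Y ω ^ 2)) / 2) μ :=
    (hXi.add hYi).div_const 2
  have hint : Integrable (fun ω => Real.exp (θ * |X ω * Y ω|)) μ :=
    hi.mono' (by fun_prop) (ae_of_all _ fun ω => by
      rw [Real.norm_eq_abs, abs_of_pos (Real.exp_pos _)]; exact hpt ω)
  refine ⟨hint, (integral_mono hint hi hpt).trans ?_⟩
  rw [integral_div, integral_add hXi hYi]
  linarith

/-- Taylor's remainder settles `|z| ≤ 1`; beyond that `z² ≥ |z| ≥ 1` and the last term dominates.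
Keeping the linear term exact lets the mean cancel in `mgf_centred_le`. -/
lemma exp_le_one_add_add_sq_mul_exp_abs (z : ℝ) :
    Real.exp z ≤ 1 + z + z ^ 2 * Real.exp |z| := by
  have h1 : 1 ≤ Real.exp |z| := Real.one_le_exp (abs_nonneg z)
  rcases le_total |z| 1 with h | h
  · have := (abs_le.1 (Real.norm_exp_sub_one_sub_id_le (x := z) h)).2
    rw [Real.norm_eq_abs, sq_abs] at this
    nlinarith [sq_nonneg z]
  · rcases le_total 0 z with hz | hz
    · rw [abs_of_nonneg hz] at *
      have : 1 * Real.exp z ≤ z ^ 2 * Real.exp z := by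
        gcongr
        nlinarith
      linarith
    · have : Real.exp z ≤ 1 := Real.exp_le_one_iff.2 hz
      rw [abs_of_nonpos hz] at *
      nlinarith

/-- The available exponent `θ|Z|` is split in two: one half dominates `exp |tZ|`, the other absorbs
`Z² ≤ (8/θ²) exp(θ|Z|/2)`. Taking expectations doubles 8 to 16, and the factor `exp(-t E Z)` removes
the linear term. -/
lemma mgf_centred_le {Ω : Type*} [MeasurableSpace Ω] {μ : Measure Ω} [IsProbabilityMeasure μ]
    {Z : Ω → ℝ} (hZ : Measurable Z) {θ : ℝ} (hθ : 0 < θ)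
    (hi : Integrable (fun ω => Real.exp (θ * |Z ω|)) μ)
    (h2 : ∫ ω, Real.exp (θ * |Z ω|) ∂μ ≤ 2) {t : ℝ} (ht : |t| ≤ θ / 2) :
    Integrable (fun ω => Real.exp (t * (Z ω - ∫ ω, Z ω ∂μ))) μ ∧
      mgf (fun ω => Z ω - ∫ ω, Z ω ∂μ) μ t ≤ Real.exp (16 / θ ^ 2 * t ^ 2) := by
  have hZi : Integrable Z μ := by
    refine (hi.const_mul θ⁻¹).mono' (by fun_prop) (ae_of_all _ fun ω => ?_)
    rw [Real.norm_eq_abs, inv_mul_eq_div, le_div_iff₀ hθ]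
    linarith [Real.add_one_le_exp (θ * |Z ω|)]
  have hexp : Integrable (fun ω => Real.exp (t * Z ω)) μ := by
    refine hi.mono' (by fun_prop) (ae_of_all _ fun ω => ?_)
    rw [Real.norm_eq_abs, abs_of_pos (Real.exp_pos _)]
    refine Real.exp_le_exp.2 ((le_abs_self _).trans ?_)
    rw [abs_mul]
    exact mul_le_mul_of_nonneg_right (by linarith) (abs_nonneg _)
  have hpt : ∀ ω, Real.exp (t * Z ω)
      ≤ 1 + t * Z ω + 8 / θ ^ 2 * t ^ 2 * Real.exp (θ * |Z ω|) := by
    intro ω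
    refine (exp_le_one_add_add_sq_mul_exp_abs (t * Z ω)).trans ?_
    have h3 := Real.quadratic_le_exp_of_nonneg (x := θ / 2 * |Z ω|) (by positivity)
    have h4 : Real.exp |t * Z ω| ≤ Real.exp (θ / 2 * |Z ω|) := by
      rw [abs_mul]
      exact Real.exp_le_exp.2 (mul_le_mul_of_nonneg_right ht (abs_nonneg _))
    have h5 : Real.exp (θ * |Z ω|) = Real.exp (θ / 2 * |Z ω|) * Real.exp (θ / 2 * |Z ω|) := by
      rw [← Real.exp_add]; congr 1; ring
    have h6 : Z ω ^ 2 ≤ 8 / θ ^ 2 * Real.exp (θ / 2 * |Z ω|) := by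
      rw [div_mul_eq_mul_div, le_div_iff₀ (by positivity)]
      have : (0 : ℝ) ≤ θ / 2 * |Z ω| := by positivity
      nlinarith [sq_abs (Z ω)]
    have h7 : (t * Z ω) ^ 2 * Real.exp |t * Z ω|
        ≤ (t ^ 2 * (8 / θ ^ 2 * Real.exp (θ / 2 * |Z ω|))) * Real.exp (θ / 2 * |Z ω|) := by
      rw [mul_pow]
      gcongr
    rw [h5]
    linarith
  have hexp' : ∀ ω, Real.exp (t * (Z ω - ∫ ω, Z ω ∂μ))
      = Real.exp (t * Z ω) * Real.exp (-(t * ∫ ω, Z ω ∂μ)) := fun ω => by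
    rw [← Real.exp_add]; congr 1; ring
  refine ⟨by simp_rw [hexp']; exact hexp.mul_const _, ?_⟩
  have hmain : ∫ ω, Real.exp (t * Z ω) ∂μ
      ≤ Real.exp (t * ∫ ω, Z ω ∂μ + 16 / θ ^ 2 * t ^ 2) := by
    have hi' : Integrable (fun ω => 1 + t * Z ω) μ :=
      (integrable_const (1 : ℝ)).add (hZi.const_mul t)
    refine (integral_mono hexp (hi'.add (hi.const_mul (8 / θ ^ 2 * t ^ 2))) hpt).trans ?_
    simp only [Pi.add_apply]
    rw [integral_add hi' (hi.const_mul _),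
      integral_add (integrable_const (1 : ℝ)) (hZi.const_mul t), integral_const_mul,
      integral_const_mul]
    simp only [integral_const, probReal_univ, smul_eq_mul, one_mul]
    have h8 : 8 / θ ^ 2 * t ^ 2 * ∫ ω, Real.exp (θ * |Z ω|) ∂μ ≤ 8 / θ ^ 2 * t ^ 2 * 2 :=
      mul_le_mul_of_nonneg_left h2 (by positivity)
    have h9 := Real.add_one_le_exp (t * ∫ ω, Z ω ∂μ + 16 / θ ^ 2 * t ^ 2)
    have h10 : 8 / θ ^ 2 * t ^ 2 * 2 = 16 / θ ^ 2 * t ^ 2 := by ring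
    linarith
  simp only [mgf]
  simp_rw [hexp']
  rw [integral_mul_const]
  calc (∫ ω, Real.exp (t * Z ω) ∂μ) * Real.exp (-(t * ∫ ω, Z ω ∂μ))
      ≤ Real.exp (t * ∫ ω, Z ω ∂μ + 16 / θ ^ 2 * t ^ 2) * Real.exp (-(t * ∫ ω, Z ω ∂μ)) := by
        gcongr
    _ = Real.exp (16 / θ ^ 2 * t ^ 2) := by rw [← Real.exp_add]; congr 1; ring

/-- Bernstein's inequality for weighted sums of independent sub-exponential variables, in the
regime where the deviation is at most of the order of the variance proxy `s`. -/
lemma bernstein_one_sided {Ω ι : Type*} [Fintype ι] [MeasurableSpace Ω] {μ : Measure Ω}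
    [IsProbabilityMeasure μ] {Z : ι → Ω → ℝ} (hZ : ∀ i, Measurable (Z i)) (hind : iIndepFun Z μ)
    {θ : ℝ} (hθ : 0 < θ) (hθ1 : θ ≤ 1)
    (hi : ∀ i, Integrable (fun ω => Real.exp (θ * |Z i ω|)) μ)
    (h2 : ∀ i, ∫ ω, Real.exp (θ * |Z i ω|) ∂μ ≤ 2) {w : ι → ℝ} (hw : ∀ i, |w i| ≤ 1) {s δ : ℝ}
    (hs : ∑ i, w i ^ 2 ≤ s) (hδ : 0 ≤ δ) (hδ1 : δ ≤ 1) :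
    μ.real {ω | δ * s / 4 ≤ ∑ i, w i * (Z i ω - ∫ ω, Z i ω ∂μ)}
      ≤ Real.exp (-(θ ^ 2 / 1024 * δ ^ 2 * s)) := by
  set X : ι → Ω → ℝ := fun i ω => w i * (Z i ω - ∫ ω, Z i ω ∂μ) with hX
  have hXm : ∀ i, Measurable (X i) := fun i => by
    have := hZ i
    fun_prop
  have hXind : iIndepFun X μ :=
    hind.comp (fun i z => w i * (z - ∫ ω, Z i ω ∂μ)) (fun i => by fun_prop)
  -- This `t` minimises the Chernoff exponent `16 t² s / θ² - t δ s / 4`; the minimum is `-θ² δ² s /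
  -- 1024`. It is admissible because `θ, δ ≤ 1` force `t ≤ θ / 2`.
  set t : ℝ := θ ^ 2 / 128 * δ with ht
  have ht0 : 0 ≤ t := by positivity
  have htθ : t ≤ θ / 2 := by
    have : θ ^ 2 / 128 * δ ≤ θ ^ 2 / 128 * 1 := by gcongr
    nlinarith
  have htw : ∀ i, |t * w i| ≤ θ / 2 := fun i => by
    rw [abs_mul, abs_of_nonneg ht0]
    nlinarith [hw i, abs_nonneg (w i)]
  have hmgf : ∀ i, Integrable (fun ω => Real.exp (t * X i ω)) μ ∧
      mgf (X i) μ t ≤ Real.exp (16 / θ ^ 2 * (t * w i) ^ 2) := by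
    intro i
    have := mgf_centred_le (hZ i) hθ (hi i) (h2 i) (htw i)
    simp only [hX, mgf, ← mul_assoc] at this ⊢
    exact this
  have hsum : (fun ω => ∑ i, X i ω) = ∑ i, X i := by
    ext ω; simp
  have hint : Integrable (fun ω => Real.exp (t * (∑ i, X i) ω)) μ :=
    hXind.integrable_exp_mul_sum hXm fun i _ => (hmgf i).1
  have hch := measure_ge_le_exp_mul_mgf (X := ∑ i, X i) (μ := μ) (δ * s / 4) ht0 hint
  rw [hXind.mgf_sum hXm] at hch
  have hprod : ∏ i, mgf (X i) μ t ≤ Real.exp (16 / θ ^ 2 * t ^ 2 * s) := by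
    calc ∏ i, mgf (X i) μ t ≤ ∏ i, Real.exp (16 / θ ^ 2 * (t * w i) ^ 2) :=
          Finset.prod_le_prod (fun i _ => mgf_nonneg) fun i _ => (hmgf i).2
      _ = Real.exp (16 / θ ^ 2 * t ^ 2 * ∑ i, w i ^ 2) := by
          rw [← Real.exp_sum, Finset.mul_sum]
          congr 1
          exact Finset.sum_congr rfl fun i _ => by ring
      _ ≤ _ := by gcongr
  have hset : {ω | δ * s / 4 ≤ ∑ i, w i * (Z i ω - ∫ ω, Z i ω ∂μ)}
      = {ω | δ * s / 4 ≤ (∑ i, X i) ω} := by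
    ext ω; simp [hX]
  rw [hset]
  refine hch.trans ?_
  calc Real.exp (-t * (δ * s / 4)) * ∏ i, mgf (X i) μ t
      ≤ Real.exp (-t * (δ * s / 4)) * Real.exp (16 / θ ^ 2 * t ^ 2 * s) := by gcongr
    _ = Real.exp (-(θ ^ 2 / 1024 * δ ^ 2 * s)) := by
        rw [← Real.exp_add]
        congr 1
        rw [ht]
        field_simp
        ring

lemma bernstein {Ω ι : Type*} [Fintype ι] [MeasurableSpace Ω] {μ : Measure Ω}
    [IsProbabilityMeasure μ] {Z : ι → Ω → ℝ} (hZ : ∀ i, Measurable (Z i)) (hind : iIndepFun Z μ)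
    {θ : ℝ} (hθ : 0 < θ) (hθ1 : θ ≤ 1)
    (hi : ∀ i, Integrable (fun ω => Real.exp (θ * |Z i ω|)) μ)
    (h2 : ∀ i, ∫ ω, Real.exp (θ * |Z i ω|) ∂μ ≤ 2) {w : ι → ℝ} (hw : ∀ i, |w i| ≤ 1) {s δ : ℝ}
    (hs : ∑ i, w i ^ 2 ≤ s) (hδ : 0 ≤ δ) (hδ1 : δ ≤ 1) :
    μ.real {ω | δ * s / 4 ≤ |∑ i, w i * (Z i ω - ∫ ω, Z i ω ∂μ)|}
      ≤ 2 * Real.exp (-(θ ^ 2 / 1024 * δ ^ 2 * s)) := by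
  have h1 := bernstein_one_sided hZ hind hθ hθ1 hi h2 hw hs hδ hδ1
  have h3 := bernstein_one_sided hZ hind hθ hθ1 hi h2 (w := fun i => -w i)
    (fun i => by simpa using hw i) (s := s) (by simpa using hs) hδ hδ1
  have hsub : {ω | δ * s / 4 ≤ |∑ i, w i * (Z i ω - ∫ ω, Z i ω ∂μ)|}
      ⊆ {ω | δ * s / 4 ≤ ∑ i, w i * (Z i ω - ∫ ω, Z i ω ∂μ)} ∪
        {ω | δ * s / 4 ≤ ∑ i, -w i * (Z i ω - ∫ ω, Z i ω ∂μ)} := by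
    intro ω hω
    have hω' : δ * s / 4 ≤ |∑ i, w i * (Z i ω - ∫ ω, Z i ω ∂μ)| := hω
    rcases le_abs.1 hω' with h | h
    · exact Or.inl h
    · refine Or.inr ?_
      simpa [Finset.sum_neg_distrib] using h
  refine (measureReal_mono hsub).trans ((measureReal_union_le _ _).trans ?_)
  linarith

/-! ### Nets of the unit ball -/

/-- A 1/2-separated subset of the unit ball of maximal cardinality is a net, since an uncovered
point could be added to it. Dilation by 2 gives a 1-separated set in the ball of radius 2, to which
the Besicovitch packing bound applies. -/
lemma exists_half_net (E : Type*) [NormedAddCommGroup E] [NormedSpace ℝ E]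
    [FiniteDimensional ℝ E] :
    ∃ s : Finset E, s.card ≤ 5 ^ Module.finrank ℝ E ∧ (∀ c ∈ s, ‖c‖ ≤ 1) ∧
      ∀ x : E, ‖x‖ ≤ 1 → ∃ c ∈ s, ‖x - c‖ ≤ 1 / 2 := by
  classical
  let P : Finset E → Prop := fun s =>
    (∀ c ∈ s, ‖c‖ ≤ 1) ∧ ∀ c ∈ s, ∀ d ∈ s, c ≠ d → 1 / 2 ≤ ‖c - d‖
  have hcard : ∀ s, P s → s.card ≤ 5 ^ Module.finrank ℝ E := by
    intro s hs
    have hinj : Function.Injective fun c : E => (2 : ℝ) • c :=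
      smul_right_injective E (two_ne_zero)
    rw [← Finset.card_image_of_injective s hinj]
    apply Besicovitch.card_le_of_separated
    · intro c hc
      obtain ⟨b, hb, rfl⟩ := Finset.mem_image.1 hc
      rw [norm_smul, Real.norm_eq_abs, abs_two]
      linarith [hs.1 b hb]
    · intro c hc d hd hcd
      obtain ⟨b, hb, rfl⟩ := Finset.mem_image.1 hc
      obtain ⟨b', hb', rfl⟩ := Finset.mem_image.1 hd
      rw [← smul_sub, norm_smul, Real.norm_eq_abs, abs_two]
      linarith [hs.2 b hb b' hb' fun h => hcd (by rw [h])]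
  obtain ⟨s, hs, hmax⟩ : ∃ s, P s ∧ ∀ s', P s' → s'.card ≤ s.card := by
    have hne : {k | ∃ s, P s ∧ s.card = k}.Nonempty := ⟨0, ∅, by simp [P], rfl⟩
    have hbdd : BddAbove {k | ∃ s, P s ∧ s.card = k} :=
      ⟨_, by rintro k ⟨s, hs, rfl⟩; exact hcard s hs⟩
    obtain ⟨s, hs, hk⟩ := Nat.sSup_mem hne hbdd
    exact ⟨s, hs, fun s' hs' => hk ▸ le_csSup hbdd ⟨s', hs', rfl⟩⟩
  refine ⟨s, hcard s hs, hs.1, fun x hx => ?_⟩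
  by_contra! hcon
  have hxs : x ∉ s := fun h => by
    have := hcon x h
    rw [sub_self, norm_zero] at this
    linarith
  have := hmax (insert x s) ⟨?_, ?_⟩
  · rw [Finset.card_insert_of_notMem hxs] at this
    omega
  · intro c hc
    rcases Finset.mem_insert.1 hc with rfl | hc
    exacts [hx, hs.1 c hc]
  · intro c hc d hd hcd
    rcases Finset.mem_insert.1 hc with hc | hc <;> rcases Finset.mem_insert.1 hd with hd | hd
    · exact absurd (hc.trans hd.symm) hcd
    · rw [hc]
      exact (hcon d hd).le
    · rw [norm_sub_rev, hd]
      exact (hcon c hc).le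
    · exact hs.2 c hc d hd hcd

lemma opNorm_le_of_half_net {E F : Type*} [NormedAddCommGroup E] [NormedSpace ℝ E]
    [NormedAddCommGroup F] [NormedSpace ℝ F] {s : Set E}
    (hs : ∀ x : E, ‖x‖ ≤ 1 → ∃ c ∈ s, ‖x - c‖ ≤ 1 / 2) {T : E →L[ℝ] F} {r : ℝ}
    (hr : ∀ c ∈ s, ‖T c‖ ≤ r) : ‖T‖ ≤ 2 * r := by
  have hr0 : 0 ≤ r := by
    obtain ⟨c, hc, -⟩ := hs 0 (by simp)
    exact (norm_nonneg _).trans (hr c hc)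
  have : ‖T‖ ≤ r + ‖T‖ * (1 / 2) := by
    refine T.opNorm_le_of_unit_norm (by positivity) fun x hx => ?_
    obtain ⟨c, hc, hxc⟩ := hs x hx.le
    calc ‖T x‖ = ‖T c + T (x - c)‖ := by rw [← map_add]; congr 2; abel
      _ ≤ ‖T c‖ + ‖T (x - c)‖ := norm_add_le _ _
      _ ≤ r + ‖T‖ * (1 / 2) := add_le_add (hr c hc)
          ((T.le_opNorm _).trans (by gcongr))
  linarith

/-- Currying reduces to operator norms: each of the two nets costs a factor 2, which is why the
pointwise tail bounds are taken at level `r / 4`. -/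
lemma bilin_le_of_half_nets {E F : Type*} [NormedAddCommGroup E] [NormedSpace ℝ E]
    [FiniteDimensional ℝ E] [NormedAddCommGroup F] [NormedSpace ℝ F] [FiniteDimensional ℝ F]
    {s : Set E} {s' : Set F} (hs : ∀ x : E, ‖x‖ ≤ 1 → ∃ c ∈ s, ‖x - c‖ ≤ 1 / 2)
    (hs' : ∀ x : F, ‖x‖ ≤ 1 → ∃ c ∈ s', ‖x - c‖ ≤ 1 / 2) {B : E →ₗ[ℝ] F →ₗ[ℝ] ℝ} {r : ℝ}
    (hr : ∀ c ∈ s, ∀ d ∈ s', |B c d| ≤ r) (u : E) (v : F) : |B u v| ≤ 4 * r * ‖u‖ * ‖v‖ := by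
  let T : E →L[ℝ] F →L[ℝ] ℝ := LinearMap.toContinuousLinearMap
    ((LinearMap.toContinuousLinearMap : (F →ₗ[ℝ] ℝ) ≃ₗ[ℝ] F →L[ℝ] ℝ).toLinearMap ∘ₗ B)
  have hT : ∀ u v, T u v = B u v := fun u v => rfl
  have h : ‖T‖ ≤ 2 * (2 * r) :=
    opNorm_le_of_half_net hs fun c hc => opNorm_le_of_half_net hs' fun d hd => by
      rw [hT, Real.norm_eq_abs]
      exact hr c hc d hd
  calc |B u v| = ‖T u v‖ := by rw [hT, Real.norm_eq_abs]
    _ ≤ ‖T‖ * ‖u‖ * ‖v‖ := T.le_opNorm₂ u v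
    _ ≤ 4 * r * ‖u‖ * ‖v‖ := by gcongr; linarith

/-- A tail bound for a random bilinear form at fixed unit vectors extends to a uniform one. -/
lemma measure_bilin_le {Ω : Type*} [MeasurableSpace Ω] {μ : Measure Ω} [IsProbabilityMeasure μ]
    {E F : Type*} [NormedAddCommGroup E] [NormedSpace ℝ E]
    [FiniteDimensional ℝ E] [NormedAddCommGroup F] [NormedSpace ℝ F] [FiniteDimensional ℝ F]
    (B : Ω → E →ₗ[ℝ] F →ₗ[ℝ] ℝ) {r q : ℝ} (hq : 0 ≤ q)
    (hB : ∀ u v, ‖u‖ ≤ 1 → ‖v‖ ≤ 1 → μ.real {ω | r / 4 ≤ |B ω u v|} ≤ q) :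
    μ.real {ω | ¬ ∀ u v, |B ω u v| ≤ r * ‖u‖ * ‖v‖}
      ≤ 5 ^ Module.finrank ℝ E * 5 ^ Module.finrank ℝ F * q := by
  obtain ⟨s, hsc, hs1, hs⟩ := exists_half_net E
  obtain ⟨s', hsc', hs1', hs'⟩ := exists_half_net F
  have hsub : {ω | ¬ ∀ u v, |B ω u v| ≤ r * ‖u‖ * ‖v‖}
      ⊆ ⋃ c ∈ s, ⋃ d ∈ s', {ω | r / 4 ≤ |B ω c d|} := by
    intro ω hω
    by_contra hcon
    simp only [Set.mem_iUnion, Set.mem_ofPred_eq, not_exists, not_le] at hcon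
    refine hω fun u v => ?_
    have := bilin_le_of_half_nets (s := (s : Set E)) (s' := (s' : Set F)) hs hs' (B := B ω)
      (r := r / 4) (fun c hc d hd => (hcon c hc d hd).le) u v
    rwa [mul_div_cancel₀ _ (by norm_num : (4 : ℝ) ≠ 0)] at this
  refine (measureReal_mono hsub (measure_ne_top _ _)).trans ((measureReal_biUnion_finset_le _ _).trans ?_)
  calc ∑ c ∈ s, μ.real (⋃ d ∈ s', {ω | r / 4 ≤ |B ω c d|})
      ≤ ∑ c ∈ s, ∑ d ∈ s', q := Finset.sum_le_sum fun c hc =>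
        (measureReal_biUnion_finset_le _ _).trans
          (Finset.sum_le_sum fun d hd => hB c d (hs1 c hc) (hs1' d hd))
    _ = s.card * s'.card * q := by simp [mul_assoc]
    _ ≤ 5 ^ Module.finrank ℝ E * 5 ^ Module.finrank ℝ F * q := by
        gcongr <;> exact_mod_cast ‹_›

/-! ### Sensing ensembles -/

namespace IsSensingEnsemble

variable {n m p : ℕ} {Ω : Type*} [MeasurableSpace Ω] {μ : Measure Ω}
  {a : Fin m → Fin p → Ω → EuclideanSpace ℝ (Fin n)} {K : ℝ≥0}

lemma measurable_inner (ha : IsSensingEnsemble a μ K) (i : Fin m) (l : Fin p)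
    (u : EuclideanSpace ℝ (Fin n)) : Measurable fun ω => inner ℝ (a i l ω) u :=
  (ha.measurable i l).inner_const

lemma psi2Norm_le (ha : IsSensingEnsemble a μ K) (i : Fin m) (l : Fin p)
    {u : EuclideanSpace ℝ (Fin n)} (hu : ‖u‖ = 1) :
    psi2Norm (fun ω => inner ℝ (a i l ω) u) μ ≤ K :=
  (le_iSup₂ (f := fun (u : EuclideanSpace ℝ (Fin n)) (_ : ‖u‖ = 1) =>
    psi2Norm (fun ω => inner ℝ (a i l ω) u) μ) u hu).trans (ha.subGaussian i l)

/-- Net points lie in the unit ball and not on the sphere; shortening `u` only decreases the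
integrand. -/
lemma integral_exp_inner_sq_le_two [IsProbabilityMeasure μ] (ha : IsSensingEnsemble a μ K)
    (i : Fin m) (l : Fin p) {θ : ℝ} (hθ : 0 ≤ θ) (hθK : 12 * θ * (K : ℝ) ^ 2 ≤ 1)
    {u : EuclideanSpace ℝ (Fin n)} (hu : ‖u‖ ≤ 1) :
    Integrable (fun ω => Real.exp (θ * inner ℝ (a i l ω) u ^ 2)) μ ∧
      ∫ ω, Real.exp (θ * inner ℝ (a i l ω) u ^ 2) ∂μ ≤ 2 := by
  rcases eq_or_ne u 0 with rfl | hu0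
  · simp
  have hpos : 0 < ‖u‖ := norm_pos_iff.2 hu0
  have h1 := integral_exp_sq_le_two (ha.measurable_inner i l (‖u‖⁻¹ • u))
    (ha.psi2Norm_le i l (norm_smul_inv_norm (𝕜 := ℝ) hu0)) hθ hθK
  have hmeas := ha.measurable_inner i l u
  have hpt : ∀ ω, Real.exp (θ * inner ℝ (a i l ω) u ^ 2)
      ≤ Real.exp (θ * inner ℝ (a i l ω) (‖u‖⁻¹ • u) ^ 2) := by
    intro ω
    rw [inner_smul_right, mul_pow]
    refine Real.exp_le_exp.2 (mul_le_mul_of_nonneg_left ?_ hθ)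
    exact le_mul_of_one_le_left (sq_nonneg _) (one_le_pow₀ ((one_le_inv₀ hpos).2 hu))
  have hint : Integrable (fun ω => Real.exp (θ * inner ℝ (a i l ω) u ^ 2)) μ :=
    h1.1.mono' ((hmeas.pow_const 2).const_mul θ).exp.aestronglyMeasurable (ae_of_all _ fun ω => by
      rw [Real.norm_eq_abs, abs_of_pos (Real.exp_pos _)]; exact hpt ω)
  exact ⟨hint, (integral_mono hint h1.1 hpt).trans h1.2⟩

lemma memLp_apply (ha : IsSensingEnsemble a μ K) (i : Fin m) (l : Fin p) (j : Fin n) :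
    MemLp (fun ω => a i l ω j) 2 μ := by
  have h := ha.psi2Norm_le i l (u := EuclideanSpace.single j 1) (by simp)
  have h1 := (le_iSup₂ (f := fun (q : ℝ) (_ : 1 ≤ q) => ENNReal.ofReal (q ^ (-(1 / 2) : ℝ)) *
      eLpNorm (fun ω => inner ℝ (a i l ω) (EuclideanSpace.single j 1)) (ENNReal.ofReal q) μ)
      2 (by norm_num)).trans h
  have heq : (fun ω => inner ℝ (a i l ω) (EuclideanSpace.single j (1 : ℝ)))
      = fun ω => a i l ω j := by
    ext ω; simp [EuclideanSpace.inner_single_right]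
  have hmeas := ha.measurable_inner i l (EuclideanSpace.single j 1)
  rw [heq] at h1 hmeas
  refine ⟨hmeas.aestronglyMeasurable, ?_⟩
  rw [ENNReal.ofReal_ofNat] at h1
  by_contra hcon
  rw [not_lt_top_iff.1 hcon, ENNReal.mul_top] at h1
  · exact absurd h1 (by simp)
  · simpa using Real.rpow_pos_of_pos two_pos _

lemma integral_inner_mul_inner (ha : IsSensingEnsemble a μ K) (i : Fin m) (l : Fin p)
    (u v : EuclideanSpace ℝ (Fin n)) :
    ∫ ω, inner ℝ (a i l ω) u * inner ℝ (a i l ω) v ∂μ = inner ℝ u v := by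
  have hint : ∀ j k, Integrable (fun ω => a i l ω j * a i l ω k) μ := fun j k =>
    (ha.memLp_apply i l j).integrable_mul (ha.memLp_apply i l k)
  have hexp : ∀ ω, inner ℝ (a i l ω) u * inner ℝ (a i l ω) v
      = ∑ j, ∑ k, u j * v k * (a i l ω j * a i l ω k) := by
    intro ω
    simp only [PiLp.inner_apply, RCLike.inner_apply, conj_trivial, Finset.sum_mul_sum]
    exact Finset.sum_congr rfl fun j _ => Finset.sum_congr rfl fun k _ => by ring
  simp_rw [hexp]
  rw [integral_finsetSum _ fun j _ => integrable_finsetSum _ fun k _ => (hint j k).const_mul _]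
  simp_rw [integral_finsetSum _ fun k _ => (hint _ k).const_mul _, integral_const_mul,
    ha.isotropic]
  simp [PiLp.inner_apply, mul_comm]

/-- Tail bound for weighted empirical second moments along fixed directions. -/
lemma measure_weighted_le [IsProbabilityMeasure μ] (ha : IsSensingEnsemble a μ K)
    {θ : ℝ} (hθ : 0 < θ) (hθ1 : θ ≤ 1) (hθK : 12 * θ * (K : ℝ) ^ 2 ≤ 1)
    {u v : EuclideanSpace ℝ (Fin n)} (hu : ‖u‖ ≤ 1) (hv : ‖v‖ ≤ 1)
    {w : Fin m → ℝ} (hw : ∀ i, |w i| ≤ 1) {s δ : ℝ} (hs : (∑ i, w i ^ 2) * p ≤ s)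
    (hδ : 0 ≤ δ) (hδ1 : δ ≤ 1) :
    μ.real {ω | δ * s / 4 ≤ |∑ i, ∑ l, w i *
        (inner ℝ (a i l ω) u * inner ℝ (a i l ω) v - inner ℝ u v)|}
      ≤ 2 * Real.exp (-(θ ^ 2 / 1024 * δ ^ 2 * s)) := by
  have hZ : ∀ il : Fin m × Fin p, Measurable fun ω =>
      inner ℝ (a il.1 il.2 ω) u * inner ℝ (a il.1 il.2 ω) v := fun il =>
    (ha.measurable_inner _ _ u).mul (ha.measurable_inner _ _ v)
  have hind : iIndepFun (fun (il : Fin m × Fin p) ω =>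
      inner ℝ (a il.1 il.2 ω) u * inner ℝ (a il.1 il.2 ω) v) μ :=
    ha.indep.comp (fun _ y => inner ℝ y u * inner ℝ y v) (fun _ => by fun_prop)
  have hexp := fun il : Fin m × Fin p => integral_exp_abs_mul_le_two
    (ha.measurable_inner il.1 il.2 u) (ha.measurable_inner il.1 il.2 v) hθ.le
    (ha.integral_exp_inner_sq_le_two il.1 il.2 hθ.le hθK hu).1
    (ha.integral_exp_inner_sq_le_two il.1 il.2 hθ.le hθK hv).1
    (ha.integral_exp_inner_sq_le_two il.1 il.2 hθ.le hθK hu).2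
    (ha.integral_exp_inner_sq_le_two il.1 il.2 hθ.le hθK hv).2
  have h := bernstein hZ hind hθ hθ1 (fun il => (hexp il).1) (fun il => (hexp il).2)
    (w := fun il => w il.1) (fun il => hw _) (s := s)
    (by simpa [Fintype.sum_prod_type, Finset.mul_sum, mul_comm] using hs) hδ hδ1
  simpa only [ha.integral_inner_mul_inner, Fintype.sum_prod_type] using h

end IsSensingEnsemble

/-! ### The gradient of the objective -/

section Gradient

variable {n m p : ℕ} (a : Fin m → Fin p → EuclideanSpace ℝ (Fin n))
  (x ξ : EuclideanSpace ℝ (Fin n)) (d γ : EuclideanSpace ℝ (Fin m))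

lemma objective_eq : objective (sensingMatrix a) x d ξ γ = 1 / (2 * (m : ℝ) * (p : ℝ)) *
    ∑ l, ∑ i, (γ i * inner ℝ (a i l) ξ - d i * inner ℝ (a i l) x) ^ 2 := by
  have h : ∀ i l (y : EuclideanSpace ℝ (Fin n)),
      (sensingMatrix a l *ᵥ y.ofLp) i = inner ℝ (a i l) y := by
    intro i l y
    simp [Matrix.mulVec, dotProduct, sensingMatrix, PiLp.inner_apply, mul_comm]
  simp only [objective, EuclideanSpace.norm_sq_eq, Pi.sub_apply, Matrix.mulVec_diagonal, h,
    Real.norm_eq_abs, sq_abs]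

lemma inner_gradSignal (u : EuclideanSpace ℝ (Fin n)) :
    inner ℝ (gradSignal (sensingMatrix a) x d ξ γ) u = 1 / ((m : ℝ) * p) *
      ∑ i, ∑ l, (γ i * inner ℝ (a i l) ξ - d i * inner ℝ (a i l) x) *
        (γ i * inner ℝ (a i l) u) := by
  have hlin : ∀ i l, HasFDerivAt
      (fun ξ' => (γ i * inner ℝ (a i l) ξ' - d i * inner ℝ (a i l) x) ^ 2)
      ((2 * (γ i * inner ℝ (a i l) ξ - d i * inner ℝ (a i l) x)) • γ i • innerSL ℝ (a i l)) ξ := by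
    intro i l
    have h1 : HasFDerivAt (fun ξ' => γ i * inner ℝ (a i l) ξ' - d i * inner ℝ (a i l) x)
        (γ i • innerSL ℝ (a i l)) ξ :=
      (((innerSL ℝ (a i l)).hasFDerivAt (x := ξ)).const_mul (γ i)).sub_const _
    simpa using h1.pow 2
  have hobj : HasFDerivAt (fun ξ' => objective (sensingMatrix a) x d ξ' γ)
      ((1 / (2 * (m : ℝ) * (p : ℝ))) • ∑ l, ∑ i,
        (2 * (γ i * inner ℝ (a i l) ξ - d i * inner ℝ (a i l) x)) • γ i • innerSL ℝ (a i l)) ξ := by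
    simp_rw [objective_eq]
    exact (HasFDerivAt.fun_sum fun l _ => HasFDerivAt.fun_sum fun i _ => hlin i l).const_mul _
  rw [gradSignal, gradient, InnerProductSpace.toDual_symm_apply, hobj.fderiv]
  simp only [smul_apply, sum_apply, smul_eq_mul,
    innerSL_apply_apply]
  rw [Finset.sum_comm, Finset.mul_sum, Finset.mul_sum]
  refine Finset.sum_congr rfl fun i _ => ?_
  rw [Finset.mul_sum, Finset.mul_sum]
  refine Finset.sum_congr rfl fun l _ => ?_
  ring

lemma inner_gradGain (v : EuclideanSpace ℝ (Fin m)) :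
    inner ℝ (gradGain (sensingMatrix a) x d ξ γ) v = 1 / ((m : ℝ) * p) *
      ∑ i, ∑ l, (γ i * inner ℝ (a i l) ξ - d i * inner ℝ (a i l) x) *
        (v i * inner ℝ (a i l) ξ) := by
  have hlin : ∀ i l, HasFDerivAt
      (fun γ' : EuclideanSpace ℝ (Fin m) =>
        (γ' i * inner ℝ (a i l) ξ - d i * inner ℝ (a i l) x) ^ 2)
      ((2 * (γ i * inner ℝ (a i l) ξ - d i * inner ℝ (a i l) x)) •
        (inner ℝ (a i l) ξ : ℝ) • (EuclideanSpace.proj i : EuclideanSpace ℝ (Fin m) →L[ℝ] ℝ))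
      γ := by
    intro i l
    have h1 : HasFDerivAt (fun γ' : EuclideanSpace ℝ (Fin m) =>
        γ' i * inner ℝ (a i l) ξ - d i * inner ℝ (a i l) x)
        ((inner ℝ (a i l) ξ : ℝ) • (EuclideanSpace.proj i : EuclideanSpace ℝ (Fin m) →L[ℝ] ℝ))
        γ :=
      (((EuclideanSpace.proj i : EuclideanSpace ℝ (Fin m) →L[ℝ] ℝ).hasFDerivAt
        (x := γ)).mul_const _).sub_const _
    simpa using h1.pow 2
  have hobj : HasFDerivAt (fun γ' => objective (sensingMatrix a) x d ξ γ')
      ((1 / (2 * (m : ℝ) * (p : ℝ))) • ∑ l, ∑ i,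
        (2 * (γ i * inner ℝ (a i l) ξ - d i * inner ℝ (a i l) x)) •
        (inner ℝ (a i l) ξ : ℝ) • (EuclideanSpace.proj i : EuclideanSpace ℝ (Fin m) →L[ℝ] ℝ))
      γ := by
    simp_rw [objective_eq]
    exact (HasFDerivAt.fun_sum fun l _ => HasFDerivAt.fun_sum fun i _ => hlin i l).const_mul _
  rw [gradGain, gradient, InnerProductSpace.toDual_symm_apply, hobj.fderiv]
  simp only [smul_apply, sum_apply, smul_eq_mul,
    PiLp.proj_apply]
  rw [Finset.sum_comm, Finset.mul_sum, Finset.mul_sum]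
  refine Finset.sum_congr rfl fun i _ => ?_
  rw [Finset.mul_sum, Finset.mul_sum]
  refine Finset.sum_congr rfl fun l _ => ?_
  ring

lemma gradGain_apply (i : Fin m) :
    gradGain (sensingMatrix a) x d ξ γ i = 1 / ((m : ℝ) * p) *
      ∑ l, (γ i * inner ℝ (a i l) ξ - d i * inner ℝ (a i l) x) * inner ℝ (a i l) ξ := by
  have h := inner_gradGain a x ξ d γ (EuclideanSpace.single i 1)
  rw [EuclideanSpace.inner_single_right, Finset.sum_eq_single i] at h
  · simpa using h
  · intro j _ hj
    simp [hj]
  · simp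

end Gradient

/-! ### The projection orthogonal to the all-ones vector -/

lemma projOnesPerp_mulVec {m : ℕ} (g : Fin m → ℝ) (i : Fin m) :
    (projOnesPerp m *ᵥ g) i = g i - (∑ j, g j) / m := by
  rw [projOnesPerp, Matrix.sub_mulVec, Matrix.one_mulVec, Matrix.smul_mulVec]
  simp [Matrix.mulVec, dotProduct, div_eq_inv_mul]

lemma norm_projOnesPerp_le {m : ℕ} (g : EuclideanSpace ℝ (Fin m)) :
    ‖(WithLp.toLp 2 (projOnesPerp m *ᵥ g.ofLp) : EuclideanSpace ℝ (Fin m))‖ ^ 2 ≤ ‖g‖ ^ 2 := by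
  rcases Nat.eq_zero_or_pos m with rfl | hm
  · simp [EuclideanSpace.norm_sq_eq]
  have hm' : (m : ℝ) ≠ 0 := by positivity
  simp only [EuclideanSpace.norm_sq_eq, projOnesPerp_mulVec, Real.norm_eq_abs, sq_abs, sub_sq,
    Finset.sum_add_distrib, Finset.sum_sub_distrib, Finset.sum_const, Finset.card_univ,
    Fintype.card_fin, nsmul_eq_mul, ← Finset.sum_mul, ← Finset.mul_sum]
  have h1 : 2 * (∑ i, g i) * ((∑ i, g i) / m) = 2 * ((∑ i, g i) ^ 2 / m) := by ring
  have h2 : (m : ℝ) * ((∑ i, g i) / m) ^ 2 = (∑ i, g i) ^ 2 / m := by field_simp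
  have h3 : 0 ≤ (∑ i, g i) ^ 2 / (m : ℝ) := by positivity
  rw [h1, h2]
  linarith

lemma inner_projOnesPerp {m : ℕ} (g v : EuclideanSpace ℝ (Fin m)) (hv : ∑ i, v i = 0) :
    inner ℝ (WithLp.toLp 2 (projOnesPerp m *ᵥ g.ofLp) : EuclideanSpace ℝ (Fin m)) v
      = inner ℝ g v := by
  simp only [PiLp.inner_apply, projOnesPerp_mulVec, RCLike.inner_apply, conj_trivial, mul_sub,
    Finset.sum_sub_distrib, ← Finset.sum_mul, hv, zero_mul, sub_zero]

/-! ### Regularity from concentration -/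

/-- The concentration properties of the sensing vectors that imply the regularity condition, `y`
being the direction of the signal. -/
structure WellConditioned {n m p : ℕ} (a : Fin m → Fin p → EuclideanSpace ℝ (Fin n)) (δ : ℝ)
    (y : EuclideanSpace ℝ (Fin n)) : Prop where
  covariance : ∀ u v, |∑ i, ∑ l, (inner ℝ (a i l) u * inner ℝ (a i l) v - inner ℝ u v)|
    ≤ δ * (m * p) * ‖u‖ * ‖v‖
  signal : ∀ i, |∑ l, (inner ℝ (a i l) y * inner ℝ (a i l) y - inner ℝ y y)|
    ≤ δ * p * ‖y‖ ^ 2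
  cross : ∀ u (v : EuclideanSpace ℝ (Fin m)),
    |∑ i, ∑ l, v i * (inner ℝ (a i l) y * inner ℝ (a i l) u - inner ℝ y u)|
      ≤ δ * (√m * p) * ‖y‖ * ‖u‖ * ‖v‖
  -- A single row tolerates a deviation of order `mp` instead of `p`: it enters only the gain
  -- gradient, where the normalisation `1/(mp)²` compensates for the factor `m`.
  covariance_row : ∀ i u v, |∑ l, (inner ℝ (a i l) u * inner ℝ (a i l) v - inner ℝ u v)|
    ≤ m * p * ‖u‖ * ‖v‖

namespace WellConditioned

variable {n m p : ℕ} {a : Fin m → Fin p → EuclideanSpace ℝ (Fin n)} {δ : ℝ}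
  {y : EuclideanSpace ℝ (Fin n)}

lemma abs_sum_sq_sub_le (h : WellConditioned a δ y) (u : EuclideanSpace ℝ (Fin n)) :
    |∑ i, ∑ l, inner ℝ (a i l) u ^ 2 - m * p * ‖u‖ ^ 2| ≤ δ * (m * p) * ‖u‖ ^ 2 := by
  have := h.covariance u u
  simp only [Finset.sum_sub_distrib, real_inner_self_eq_norm_sq, Finset.sum_const,
    Finset.card_univ, Fintype.card_fin, nsmul_eq_mul, ← pow_two] at this
  rwa [← mul_assoc, mul_assoc _ ‖u‖ ‖u‖, ← pow_two] at this

lemma abs_sum_signal_sq_sub_le (h : WellConditioned a δ y) (i : Fin m) :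
    |∑ l, inner ℝ (a i l) y ^ 2 - p * ‖y‖ ^ 2| ≤ δ * p * ‖y‖ ^ 2 := by
  have := h.signal i
  simpa only [Finset.sum_sub_distrib, real_inner_self_eq_norm_sq, Finset.sum_const,
    Finset.card_univ, Fintype.card_fin, nsmul_eq_mul, ← pow_two] using this

lemma sum_row_sq_le (h : WellConditioned a δ y) (i : Fin m) (u : EuclideanSpace ℝ (Fin n)) :
    ∑ l, inner ℝ (a i l) u ^ 2 ≤ 2 * (m * p) * ‖u‖ ^ 2 := by
  have h1 := (abs_le.1 (h.covariance_row i u u)).2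
  simp only [Finset.sum_sub_distrib, real_inner_self_eq_norm_sq, Finset.sum_const,
    Finset.card_univ, Fintype.card_fin, nsmul_eq_mul, ← pow_two] at h1
  have hm : (1 : ℝ) ≤ m := by exact_mod_cast i.pos
  have h2 : 1 * (p * ‖u‖ ^ 2) ≤ m * (p * ‖u‖ ^ 2) := by gcongr
  have h3 : (m * p * ‖u‖ * ‖u‖ : ℝ) = m * (p * ‖u‖ ^ 2) := by ring
  linarith

lemma abs_sum_cross_le (h : WellConditioned a δ y) (u : EuclideanSpace ℝ (Fin n))
    (v : EuclideanSpace ℝ (Fin m)) (hv : ∑ i, v i = 0) :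
    |∑ i, ∑ l, v i * (inner ℝ (a i l) y * inner ℝ (a i l) u)|
      ≤ δ * (√m * p) * ‖y‖ * ‖u‖ * ‖v‖ := by
  have h1 := h.cross u v
  simp only [mul_sub, Finset.sum_sub_distrib, Finset.sum_const, Finset.card_univ,
    Fintype.card_fin, nsmul_eq_mul] at h1
  rwa [← Finset.mul_sum, ← Finset.sum_mul, hv, zero_mul, mul_zero, sub_zero] at h1

/-- Uniformity in `v` is free: the weights `v_i²` are nonnegative, so the row estimates at the fixed
signal are simply added up. -/
lemma abs_weighted_signal_le (h : WellConditioned a δ y) (v : EuclideanSpace ℝ (Fin m)) :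
    |∑ i, ∑ l, v i ^ 2 * inner ℝ (a i l) y ^ 2 - p * ‖y‖ ^ 2 * ‖v‖ ^ 2|
      ≤ δ * p * ‖y‖ ^ 2 * ‖v‖ ^ 2 := by
  have h1 : ∑ i, ∑ l, v i ^ 2 * inner ℝ (a i l) y ^ 2 - p * ‖y‖ ^ 2 * ‖v‖ ^ 2
      = ∑ i, v i ^ 2 * (∑ l, inner ℝ (a i l) y ^ 2 - p * ‖y‖ ^ 2) := by
    simp only [EuclideanSpace.norm_sq_eq v, Real.norm_eq_abs, sq_abs, mul_sub,
      Finset.sum_sub_distrib, Finset.mul_sum]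
    congr 1
    exact Finset.sum_congr rfl fun i _ => by ring
  rw [h1]
  refine (Finset.abs_sum_le_sum_abs _ _).trans ?_
  rw [EuclideanSpace.norm_sq_eq v, Finset.mul_sum]
  refine Finset.sum_le_sum fun i _ => ?_
  rw [abs_mul, abs_of_nonneg (sq_nonneg _), Real.norm_eq_abs, sq_abs, mul_comm]
  exact mul_le_mul_of_nonneg_right (h.abs_sum_signal_sq_sub_le i) (sq_nonneg _)

variable {γ β : EuclideanSpace ℝ (Fin m)} {ρ : ℝ} {h : EuclideanSpace ℝ (Fin n)}

lemma sum_residual_sq_le (hw : WellConditioned a δ y) (hγ : ∀ i, |γ i - 1| ≤ ρ) (hρ : 0 ≤ ρ)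
    (hm : 0 < m) :
    ∑ i, ∑ l, (γ i * inner ℝ (a i l) h + β i * inner ℝ (a i l) y) ^ 2
      ≤ 2 * (1 + ρ) ^ 2 * (1 + δ) * (m * p) * (‖h‖ ^ 2 + ‖y‖ ^ 2 / m * ‖β‖ ^ 2) := by
  have h1 : ∀ i l, (γ i * inner ℝ (a i l) h + β i * inner ℝ (a i l) y) ^ 2
      ≤ 2 * (1 + ρ) ^ 2 * (inner ℝ (a i l) h ^ 2 + β i ^ 2 * inner ℝ (a i l) y ^ 2) := by
    intro i l
    have h2 : γ i ^ 2 ≤ (1 + ρ) ^ 2 := by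
      have := abs_le.1 (hγ i)
      exact sq_le_sq' (by linarith) (by linarith)
    have h3 : (1 : ℝ) ≤ (1 + ρ) ^ 2 := one_le_pow₀ (by linarith)
    have h4 := mul_le_mul_of_nonneg_right h2 (sq_nonneg (inner ℝ (a i l) h))
    have h5 := mul_le_mul_of_nonneg_right h3 (sq_nonneg (β i * inner ℝ (a i l) y))
    nlinarith [sq_nonneg (γ i * inner ℝ (a i l) h - β i * inner ℝ (a i l) y)]
  refine (Finset.sum_le_sum fun i _ => Finset.sum_le_sum fun l _ => h1 i l).trans ?_
  have h2 := (abs_le.1 (hw.abs_sum_sq_sub_le h)).2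
  have h3 := (abs_le.1 (hw.abs_weighted_signal_le β)).2
  have hm' : (m : ℝ) ≠ 0 := by positivity
  have h4 : (1 + δ) * (m * p) * (‖h‖ ^ 2 + ‖y‖ ^ 2 / m * ‖β‖ ^ 2)
      = (1 + δ) * (m * p) * ‖h‖ ^ 2 + (1 + δ) * p * ‖y‖ ^ 2 * ‖β‖ ^ 2 := by field_simp
  calc _ = 2 * (1 + ρ) ^ 2 * (∑ i, ∑ l, inner ℝ (a i l) h ^ 2
        + ∑ i, ∑ l, β i ^ 2 * inner ℝ (a i l) y ^ 2) := by
        simp only [← Finset.mul_sum, Finset.sum_add_distrib]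
    _ ≤ 2 * (1 + ρ) ^ 2 * ((1 + δ) * (m * p) * (‖h‖ ^ 2 + ‖y‖ ^ 2 / m * ‖β‖ ^ 2)) := by
        refine mul_le_mul_of_nonneg_left ?_ (by positivity)
        rw [h4]
        linarith
    _ = _ := by ring

/-- The summand is `γ(γ+β)H² + β²Y² + (2γ+β)βYH`. Here `γ(γ+β) ≥ (1-ρ)(1-3ρ) ≥ 1-4ρ`, and replacing
`2γ+β` by 2 costs at most `2ρ(H² + β²Y²)`. Concentration then yields a constant of at least
`1-6ρ-2δ`, so `9ρ` leaves slack. -/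
lemma curvature_sum_ge (hw : WellConditioned a δ y) (hγ : ∀ i, |γ i - 1| ≤ ρ)
    (hβ : ∀ i, |γ i - β i - 1| ≤ ρ) (hβ0 : ∑ i, β i = 0) (hρ : 0 ≤ ρ) (hδ : 0 ≤ δ)
    (hρδ : 9 * ρ + 2 * δ ≤ 1) (hm : 0 < m) :
    (m * p) * ((1 - 9 * ρ - 2 * δ) * (‖h‖ ^ 2 + ‖y‖ ^ 2 / m * ‖β‖ ^ 2)) ≤
    ∑ i, ∑ l, (γ i * inner ℝ (a i l) h + β i * inner ℝ (a i l) y) *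
      (γ i * inner ℝ (a i l) h + β i * (inner ℝ (a i l) y + inner ℝ (a i l) h)) := by
  have h1 : ∀ i l, (1 - 6 * ρ) * inner ℝ (a i l) h ^ 2
      + (1 - 2 * ρ) * (β i ^ 2 * inner ℝ (a i l) y ^ 2)
      + 2 * (β i * (inner ℝ (a i l) y * inner ℝ (a i l) h)) ≤
      (γ i * inner ℝ (a i l) h + β i * inner ℝ (a i l) y) *
      (γ i * inner ℝ (a i l) h + β i * (inner ℝ (a i l) y + inner ℝ (a i l) h)) := by
    intro i l
    generalize (inner ℝ (a i l) h : ℝ) = H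
    generalize (inner ℝ (a i l) y : ℝ) = Y
    have hg := abs_le.1 (hγ i)
    have hb := abs_le.1 (hβ i)
    have h2 : 1 - 4 * ρ ≤ γ i * (γ i + β i) := by
      have e1 : 1 - ρ ≤ γ i := by linarith
      have e2 : 1 - 3 * ρ ≤ γ i + β i := by linarith
      nlinarith [mul_le_mul e1 e2 (by linarith) (by linarith)]
    have h3 : |2 * (γ i - 1) + β i| ≤ 4 * ρ := abs_le.2 ⟨by linarith, by linarith⟩
    have h4 : -(2 * ρ * (H ^ 2 + (β i * Y) ^ 2))
        ≤ (2 * (γ i - 1) + β i) * ((β i * Y) * H) := by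
      have e1 : |(2 * (γ i - 1) + β i) * ((β i * Y) * H)|
          ≤ 4 * ρ * ((H ^ 2 + (β i * Y) ^ 2) / 2) := by
        rw [abs_mul]
        refine mul_le_mul h3 ?_ (abs_nonneg _) (by linarith)
        rw [abs_le]
        constructor <;> nlinarith [sq_nonneg (β i * Y - H), sq_nonneg (β i * Y + H)]
      linarith [(abs_le.1 e1).1]
    have h5 := mul_le_mul_of_nonneg_right h2 (sq_nonneg H)
    nlinarith
  refine le_trans ?_ (Finset.sum_le_sum fun i _ => Finset.sum_le_sum fun l _ => h1 i l)
  simp only [Finset.sum_add_distrib]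
  simp only [← Finset.mul_sum]
  have h2 := (abs_le.1 (hw.abs_sum_sq_sub_le h)).1
  have h3 := (abs_le.1 (hw.abs_weighted_signal_le β)).1
  have h4 := (abs_le.1 (hw.abs_sum_cross_le h β hβ0)).1
  simp only [← Finset.mul_sum] at h2 h3 h4
  have hm' : (0 : ℝ) < m := by positivity
  -- With this normalisation `Δ = ‖h‖² + b²`, and the cross deviation becomes `δ mp ‖h‖ b`, which
  -- AM-GM absorbs; this is where the `√m` in `cross` is needed.
  set b : ℝ := ‖y‖ * ‖β‖ / √m with hb
  have e1 : ‖y‖ ^ 2 / m * ‖β‖ ^ 2 = b ^ 2 := by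
    rw [hb, div_pow, Real.sq_sqrt hm'.le]; ring
  have e2 : (p : ℝ) * ‖y‖ ^ 2 * ‖β‖ ^ 2 = m * p * b ^ 2 := by
    rw [← e1]; field_simp
  have e3 : √m * p * ‖y‖ * ‖h‖ * ‖β‖ = m * p * (‖h‖ * b) := by
    rw [hb]
    calc √m * p * ‖y‖ * ‖h‖ * ‖β‖ = m / √m * (p * ‖h‖ * ‖y‖ * ‖β‖) := by
          rw [Real.div_sqrt]; ring
      _ = _ := by ring
  have e4 : δ * (√m * p) * ‖y‖ * ‖h‖ * ‖β‖ = δ * (m * p * (‖h‖ * b)) := by rw [← e3]; ring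
  have e5 : δ * p * ‖y‖ ^ 2 * ‖β‖ ^ 2 = δ * (m * p * b ^ 2) := by rw [← e2]; ring
  rw [e4] at h4
  rw [e2, e5] at h3
  rw [e1]
  have hN : (0 : ℝ) ≤ m * p := by positivity
  have h2' := mul_le_mul_of_nonneg_left h2 (show (0 : ℝ) ≤ 1 - 6 * ρ by linarith)
  have h3' := mul_le_mul_of_nonneg_left h3 (show (0 : ℝ) ≤ 1 - 2 * ρ by linarith)
  have h6 : (1 - 9 * ρ - 2 * δ) * (‖h‖ ^ 2 + b ^ 2) ≤ (1 - 6 * ρ) * (1 - δ) * ‖h‖ ^ 2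
      + (1 - 2 * ρ) * (1 - δ) * b ^ 2 - 2 * δ * (‖h‖ * b) := by
    have e1 : 2 * δ * (‖h‖ * b) ≤ δ * (‖h‖ ^ 2 + b ^ 2) := by
      nlinarith [sq_nonneg (‖h‖ - b)]
    have e2 : 0 ≤ ρ * δ := mul_nonneg hρ hδ
    have e3 : 0 ≤ ‖h‖ ^ 2 := sq_nonneg _
    have e4 : 0 ≤ b ^ 2 := sq_nonneg _
    nlinarith [mul_nonneg e2 e3, mul_nonneg e2 e4, mul_nonneg hρ e3, mul_nonneg hρ e4]
  have h7 := mul_le_mul_of_nonneg_left h6 hN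
  linarith

end WellConditioned

section Regularity

variable {n m p : ℕ} {a : Fin m → Fin p → EuclideanSpace ℝ (Fin n)} {δ ρ κ : ℝ}
  {x ξ : EuclideanSpace ℝ (Fin n)} {d γ : EuclideanSpace ℝ (Fin m)}

/-- The scalings of `x⋆` and `d⋆` are mutually inverse, so the measurements `d_i ⟨v, x⟩` are
unchanged when `(x, d)` is replaced by `(x⋆, d⋆)`. -/
lemma residual_eq (hm : 0 < m) (hd : ∀ i, 0 < d i) (i : Fin m) (v : EuclideanSpace ℝ (Fin n)) :
    γ i * inner ℝ v ξ - d i * inner ℝ v x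
      = γ i * inner ℝ v (ξ - xStar x d) + (γ - dStar d) i * inner ℝ v (xStar x d) := by
  have h1 : 0 < l1Norm d :=
    Finset.sum_pos (fun i _ => abs_pos.2 (hd i).ne') ⟨⟨0, hm⟩, Finset.mem_univ _⟩
  have h2 : dStar d i * inner ℝ v (xStar x d) = d i * inner ℝ v x := by
    simp only [dStar, xStar, PiLp.smul_apply, inner_smul_right, smul_eq_mul]
    field_simp
  rw [PiLp.sub_apply, sub_mul, h2, inner_sub_right]
  ring

lemma WellConditioned.boundedCurvature (hw : WellConditioned a δ (xStar x d)) (hm : 0 < m)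
    (hp : 0 < p) (hd : ∀ i, 0 < d i) (hdρ : dStar d ∈ gainSet m ρ) (hγ : γ ∈ gainSet m ρ)
    (hρ : 0 ≤ ρ) (hδ : 0 ≤ δ) (hρδ : 9 * ρ + 2 * δ ≤ 1) :
    BoundedCurvature (sensingMatrix a) x d (2 * (1 - 9 * ρ - 2 * δ)) ξ γ := by
  have hβ0 : ∑ i, (γ - dStar d) i = 0 := by
    have h1 := hγ.1
    have h2 := hdρ.1
    simp only [Finset.sum_sub_distrib, PiLp.sub_apply] at h1 h2 ⊢
    linarith
  have h := hw.curvature_sum_ge (γ := γ) (β := γ - dStar d) (h := ξ - xStar x d) hγ.2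
    (fun i => by
      rw [PiLp.sub_apply, sub_sub_cancel]
      exact hdρ.2 i) hβ0 hρ hδ hρδ hm
  have hN : (0 : ℝ) < m * p := by positivity
  rw [BoundedCurvature, projGrad, WithLp.prod_inner_apply]
  simp only
  rw [inner_projOnesPerp _ _ hβ0, inner_gradSignal, inner_gradGain, ← mul_add,
    ← Finset.sum_add_distrib]
  simp only [← Finset.sum_add_distrib, ← mul_add, residual_eq hm hd]
  have h3 : ∀ v : EuclideanSpace ℝ (Fin n),
      inner ℝ v ξ = inner ℝ v (xStar x d) + inner ℝ v (ξ - xStar x d) := fun v => by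
    rw [← inner_add_right, add_sub_cancel]
  simp only [h3]
  rw [dist2, ge_iff_le, one_div, ← div_eq_inv_mul, le_div_iff₀ hN]
  linarith

/-- Pair the gradient `g` with itself and apply Cauchy-Schwarz over all `mp` indices; one factor is
the residual energy, the other is of order `mp ‖g‖²`, and `‖g‖²` cancels. -/
lemma WellConditioned.norm_gradSignal_sq_le (hw : WellConditioned a δ (xStar x d)) (hm : 0 < m)
    (hp : 0 < p) (hd : ∀ i, 0 < d i) (hγ : γ ∈ gainSet m ρ) (hρ : 0 ≤ ρ) (hδ : 0 ≤ δ) :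
    ‖gradSignal (sensingMatrix a) x d ξ γ‖ ^ 2
      ≤ 2 * (1 + ρ) ^ 4 * (1 + δ) ^ 2 * dist2 x d ξ γ := by
  have hN : (0 : ℝ) < m * p := by positivity
  have hΔ : 0 ≤ dist2 x d ξ γ := by unfold dist2; positivity
  set g := gradSignal (sensingMatrix a) x d ξ γ with hg
  rcases eq_or_ne g 0 with h0 | h0
  · rw [h0, norm_zero, zero_pow two_ne_zero]
    positivity
  have hg2 : 0 < ‖g‖ ^ 2 := by have := norm_pos_iff.2 h0; positivity
  have h1 := inner_gradSignal a x ξ d γ g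
  rw [← hg, real_inner_self_eq_norm_sq, div_mul_eq_mul_div, one_mul, eq_div_iff hN.ne'] at h1
  have hres := hw.sum_residual_sq_le (γ := γ) (β := γ - dStar d) (h := ξ - xStar x d) hγ.2 hρ hm
  simp only [← residual_eq hm hd] at hres
  have hcs := Finset.sum_mul_sq_le_sq_mul_sq (Finset.univ : Finset (Fin m × Fin p))
    (fun il => γ il.1 * inner ℝ (a il.1 il.2) ξ - d il.1 * inner ℝ (a il.1 il.2) x)
    (fun il => γ il.1 * inner ℝ (a il.1 il.2) g)
  simp only [Fintype.sum_prod_type] at hcs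
  rw [← h1] at hcs
  have h2 : ∑ i, ∑ l, (γ i * inner ℝ (a i l) g) ^ 2
      ≤ (1 + ρ) ^ 2 * ((1 + δ) * (m * p) * ‖g‖ ^ 2) := by
    have h3 := (abs_le.1 (hw.abs_sum_sq_sub_le g)).2
    calc ∑ i, ∑ l, (γ i * inner ℝ (a i l) g) ^ 2
        ≤ ∑ i, ∑ l, (1 + ρ) ^ 2 * inner ℝ (a i l) g ^ 2 := by
          refine Finset.sum_le_sum fun i _ => Finset.sum_le_sum fun l _ => ?_
          rw [mul_pow]
          have := abs_le.1 (hγ.2 i)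
          have : γ i ^ 2 ≤ (1 + ρ) ^ 2 := sq_le_sq' (by linarith) (by linarith)
          gcongr
      _ = (1 + ρ) ^ 2 * ∑ i, ∑ l, inner ℝ (a i l) g ^ 2 := by simp only [Finset.mul_sum]
      _ ≤ _ := by
          gcongr
          linarith
  have h4 := hcs.trans (mul_le_mul hres h2
    (Finset.sum_nonneg fun _ _ => Finset.sum_nonneg fun _ _ => sq_nonneg _) (by positivity))
  have h5 : (‖g‖ ^ 2 * (m * p) ^ 2) * ‖g‖ ^ 2
      ≤ (2 * (1 + ρ) ^ 4 * (1 + δ) ^ 2 * dist2 x d ξ γ * (m * p) ^ 2) * ‖g‖ ^ 2 := by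
    refine le_of_eq_of_le ?_ (h4.trans_eq ?_)
    · ring
    · rw [dist2]; ring
  exact le_of_mul_le_mul_right (le_of_mul_le_mul_right h5 hg2) (by positivity)

/-- Cauchy-Schwarz is applied in `l` separately for each coordinate. The row bound is uniform in
`i`, so it factors out and leaves the total residual energy. -/
lemma WellConditioned.norm_gradGain_sq_le (hw : WellConditioned a δ (xStar x d)) (hm : 0 < m)
    (hp : 0 < p) (hd : ∀ i, 0 < d i) (hγ : γ ∈ gainSet m ρ) (hρ : 0 ≤ ρ) :
    ‖gradGain (sensingMatrix a) x d ξ γ‖ ^ 2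
      ≤ 4 * (1 + ρ) ^ 2 * (1 + δ) * dist2 x d ξ γ * ‖ξ‖ ^ 2 := by
  have hN : (0 : ℝ) < m * p := by positivity
  have hres := hw.sum_residual_sq_le (γ := γ) (β := γ - dStar d) (h := ξ - xStar x d) hγ.2 hρ hm
  simp only [← residual_eq hm hd] at hres
  rw [EuclideanSpace.norm_sq_eq]
  calc ∑ i, ‖gradGain (sensingMatrix a) x d ξ γ i‖ ^ 2
      ≤ ∑ i, (1 / ((m : ℝ) * p)) ^ 2 * (2 * (m * p) * ‖ξ‖ ^ 2) *
          ∑ l, (γ i * inner ℝ (a i l) ξ - d i * inner ℝ (a i l) x) ^ 2 := by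
        refine Finset.sum_le_sum fun i _ => ?_
        rw [Real.norm_eq_abs, sq_abs, gradGain_apply, mul_pow, mul_assoc]
        refine mul_le_mul_of_nonneg_left ?_ (by positivity)
        refine (Finset.sum_mul_sq_le_sq_mul_sq _ _ _).trans ?_
        rw [mul_comm]
        exact mul_le_mul_of_nonneg_right (hw.sum_row_sq_le i ξ)
          (Finset.sum_nonneg fun _ _ => sq_nonneg _)
    _ = (1 / ((m : ℝ) * p)) ^ 2 * (2 * (m * p) * ‖ξ‖ ^ 2) *
          ∑ i, ∑ l, (γ i * inner ℝ (a i l) ξ - d i * inner ℝ (a i l) x) ^ 2 := by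
        rw [Finset.mul_sum]
    _ ≤ (1 / ((m : ℝ) * p)) ^ 2 * (2 * (m * p) * ‖ξ‖ ^ 2) *
          (2 * (1 + ρ) ^ 2 * (1 + δ) * (m * p) * dist2 x d ξ γ) := by
        exact mul_le_mul_of_nonneg_left hres (by positivity)
    _ = 4 * (1 + ρ) ^ 2 * (1 + δ) * dist2 x d ξ γ * ‖ξ‖ ^ 2 := by
        field_simp
        ring

lemma WellConditioned.lipschitzGradient (hw : WellConditioned a δ (xStar x d)) (hm : 0 < m)
    (hp : 0 < p) (hd : ∀ i, 0 < d i) (hz : (ξ, γ) ∈ nbhd x d κ ρ) (hκ : 0 ≤ κ)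
    (hρ : 0 ≤ ρ) (hδ : 0 ≤ δ) (hρδ : 9 * ρ + 2 * δ ≤ 1) :
    LipschitzGradient (sensingMatrix a) x d
      (4 * √2 * (1 + ρ + (1 + κ) * ‖xStar x d‖)) ξ γ := by
  have hγ : γ ∈ gainSet m ρ := hz.1
  have h1 := hw.norm_gradSignal_sq_le (ξ := ξ) hm hp hd hγ hρ hδ
  have h2 := hw.norm_gradGain_sq_le (ξ := ξ) hm hp hd hγ hρ
  have h3 := norm_projOnesPerp_le (gradGain (sensingMatrix a) x d ξ γ)
  rw [LipschitzGradient, projGrad, WithLp.prod_norm_sq_eq_of_L2]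
  change ‖gradSignal (sensingMatrix a) x d ξ γ‖ ^ 2 + ‖(WithLp.toLp 2 (projOnesPerp m *ᵥ
    (gradGain (sensingMatrix a) x d ξ γ).ofLp) : EuclideanSpace ℝ (Fin m))‖ ^ 2 ≤ _
  have hΔ : 0 ≤ dist2 x d ξ γ := by unfold dist2; positivity
  have hξ : ‖ξ‖ ≤ (1 + κ) * ‖xStar x d‖ := by
    have h4 : ‖ξ - xStar x d‖ ^ 2 ≤ (κ * ‖xStar x d‖) ^ 2 := by
      have h5 : dist2 x d ξ γ ≤ κ ^ 2 * ‖xStar x d‖ ^ 2 := hz.2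
      have h6 : 0 ≤ ‖xStar x d‖ ^ 2 / (m : ℝ) * ‖γ - dStar d‖ ^ 2 := by positivity
      rw [dist2] at h5
      rw [mul_pow]
      linarith
    have h5 := le_of_sq_le_sq h4 (by positivity)
    have h6 := norm_sub_norm_le ξ (xStar x d)
    linarith
  set b : ℝ := (1 + κ) * ‖xStar x d‖ with hb
  have hb0 : 0 ≤ b := by positivity
  have hξ2 : ‖ξ‖ ^ 2 ≤ b ^ 2 := by gcongr
  -- The curvature condition gives `ρ ≤ 1/9` and `δ ≤ 1/2`, so both gradient parts fit under `32 =
  -- (4√2)²`.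
  have hρ1 : (1 + ρ) ^ 2 ≤ 2 := by nlinarith
  have hδ1 : 1 + δ ≤ 2 := by linarith
  have e1 : 2 * (1 + ρ) ^ 4 * (1 + δ) ^ 2 ≤ 32 * (1 + ρ) ^ 2 := by
    calc 2 * (1 + ρ) ^ 4 * (1 + δ) ^ 2 = 2 * (1 + ρ) ^ 2 * (1 + ρ) ^ 2 * (1 + δ) ^ 2 := by ring
      _ ≤ 2 * 2 * (1 + ρ) ^ 2 * 2 ^ 2 := by gcongr
      _ ≤ 32 * (1 + ρ) ^ 2 := by nlinarith [sq_nonneg (1 + ρ)]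
  have e2 : 4 * (1 + ρ) ^ 2 * (1 + δ) * dist2 x d ξ γ * ‖ξ‖ ^ 2
      ≤ 4 * 2 * 2 * dist2 x d ξ γ * b ^ 2 := by gcongr
  have e3 : (4 * √2 * (1 + ρ + b)) ^ 2 = 32 * (1 + ρ + b) ^ 2 := by
    rw [mul_pow, mul_pow, Real.sq_sqrt (by norm_num)]
    norm_num
  have e4 := mul_le_mul_of_nonneg_right e1 hΔ
  rw [e3]
  have e5 : 0 ≤ dist2 x d ξ γ * b ^ 2 := by positivity
  have e6 : 0 ≤ dist2 x d ξ γ * ((1 + ρ) * b) := by positivity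
  nlinarith

end Regularity

/-! ### Concentration -/

/-- The centred weighted empirical covariance form. -/
noncomputable def covarianceForm {n m p : ℕ} (a : Fin m → Fin p → EuclideanSpace ℝ (Fin n))
    (w : Fin m → ℝ) : EuclideanSpace ℝ (Fin n) →ₗ[ℝ] EuclideanSpace ℝ (Fin n) →ₗ[ℝ] ℝ :=
  LinearMap.mk₂ ℝ
    (fun u v => ∑ i, ∑ l, w i * (inner ℝ (a i l) u * inner ℝ (a i l) v - inner ℝ u v))
    (fun u u' v => by
      simp only [← Finset.sum_add_distrib, inner_add_right, inner_add_left]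
      exact Finset.sum_congr rfl fun i _ => Finset.sum_congr rfl fun l _ => by ring)
    (fun c u v => by
      simp only [smul_eq_mul, Finset.mul_sum, inner_smul_right, real_inner_smul_left]
      exact Finset.sum_congr rfl fun i _ => Finset.sum_congr rfl fun l _ => by ring)
    (fun u v v' => by
      simp only [← Finset.sum_add_distrib, inner_add_right]
      exact Finset.sum_congr rfl fun i _ => Finset.sum_congr rfl fun l _ => by ring)
    (fun c u v => by
      simp only [smul_eq_mul, Finset.mul_sum, inner_smul_right]
      exact Finset.sum_congr rfl fun i _ => Finset.sum_congr rfl fun l _ => by ring)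

/-- The centred bilinear form coupling signal and gain perturbations. -/
noncomputable def crossForm {n m p : ℕ} (a : Fin m → Fin p → EuclideanSpace ℝ (Fin n))
    (y : EuclideanSpace ℝ (Fin n)) :
    EuclideanSpace ℝ (Fin n) →ₗ[ℝ] EuclideanSpace ℝ (Fin m) →ₗ[ℝ] ℝ :=
  LinearMap.mk₂ ℝ
    (fun u v => ∑ i, ∑ l, v i * (inner ℝ (a i l) y * inner ℝ (a i l) u - inner ℝ y u))
    (fun u u' v => by
      simp only [← Finset.sum_add_distrib, inner_add_right]
      exact Finset.sum_congr rfl fun i _ => Finset.sum_congr rfl fun l _ => by ring)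
    (fun c u v => by
      simp only [smul_eq_mul, Finset.mul_sum, inner_smul_right]
      exact Finset.sum_congr rfl fun i _ => Finset.sum_congr rfl fun l _ => by ring)
    (fun u v v' => by
      simp only [← Finset.sum_add_distrib, PiLp.add_apply]
      exact Finset.sum_congr rfl fun i _ => Finset.sum_congr rfl fun l _ => by ring)
    (fun c u v => by
      simp only [smul_eq_mul, Finset.mul_sum, PiLp.smul_apply]
      exact Finset.sum_congr rfl fun i _ => Finset.sum_congr rfl fun l _ => by ring)

namespace IsSensingEnsemble

variable {n m p : ℕ} {Ω : Type*} [MeasurableSpace Ω] {μ : Measure Ω} [IsProbabilityMeasure μ]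
  {a : Fin m → Fin p → Ω → EuclideanSpace ℝ (Fin n)} {K : ℝ≥0} {θ δ : ℝ}

lemma measure_covariance_le (ha : IsSensingEnsemble a μ K) (hθ : 0 < θ) (hθ1 : θ ≤ 1)
    (hθK : 12 * θ * (K : ℝ) ^ 2 ≤ 1) (hδ : 0 ≤ δ) (hδ1 : δ ≤ 1) :
    μ.real {ω | ¬ ∀ u v, |∑ i, ∑ l,
        (inner ℝ (a i l ω) u * inner ℝ (a i l ω) v - inner ℝ u v)| ≤ δ * (m * p) * ‖u‖ * ‖v‖}
      ≤ 5 ^ n * 5 ^ n * (2 * Real.exp (-(θ ^ 2 / 1024 * δ ^ 2 * (m * p)))) := by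
  have h := measure_bilin_le (μ := μ) (fun ω => covarianceForm (fun i l => a i l ω) fun _ => 1)
    (r := δ * (m * p)) (q := 2 * Real.exp (-(θ ^ 2 / 1024 * δ ^ 2 * (m * p)))) (by positivity)
    (fun u v hu hv => ha.measure_weighted_le hθ hθ1 hθK hu hv (w := fun _ => 1) (by simp)
      (s := m * p) (by simp) hδ hδ1)
  simpa [covarianceForm] using h

/-- Bernstein is used with relative deviation 1 and the inflated proxy `s = mp` in place of the true
`p`; the resulting exponent of order `mp` is what can pay for a net in every row. -/
lemma measure_covariance_row_le (ha : IsSensingEnsemble a μ K) (hθ : 0 < θ) (hθ1 : θ ≤ 1)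
    (hθK : 12 * θ * (K : ℝ) ^ 2 ≤ 1) (i : Fin m) :
    μ.real {ω | ¬ ∀ u v, |∑ l,
        (inner ℝ (a i l ω) u * inner ℝ (a i l ω) v - inner ℝ u v)| ≤ m * p * ‖u‖ * ‖v‖}
      ≤ 5 ^ n * 5 ^ n * (2 * Real.exp (-(θ ^ 2 / 1024 * (m * p)))) := by
  have hm : (1 : ℝ) ≤ m := by exact_mod_cast i.pos
  have hw : ∀ j, |(Pi.single i 1 : Fin m → ℝ) j| ≤ 1 := fun j => by
    rcases eq_or_ne j i with rfl | h <;> simp [*]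
  have hs : (∑ j, (Pi.single i 1 : Fin m → ℝ) j ^ 2) * p ≤ m * p := by
    rw [Finset.sum_eq_single i (fun j _ hj => by simp [hj]) (by simp)]
    rw [Pi.single_eq_same, one_pow]
    gcongr
  have h := measure_bilin_le (μ := μ)
    (fun ω => covarianceForm (fun i l => a i l ω) (Pi.single i 1))
    (r := 1 * (m * p)) (q := 2 * Real.exp (-(θ ^ 2 / 1024 * 1 ^ 2 * (m * p)))) (by positivity)
    (fun u v hu hv => ha.measure_weighted_le hθ hθ1 hθK hu hv hw hs zero_le_one le_rfl)
  have heq : ∀ ω u v, covarianceForm (fun i l => a i l ω) (Pi.single i 1) u v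
      = ∑ l, (inner ℝ (a i l ω) u * inner ℝ (a i l ω) v - inner ℝ u v) := fun ω u v => by
    rw [covarianceForm, LinearMap.mk₂_apply,
      Finset.sum_eq_single i (fun j _ hj => by simp [hj]) (by simp)]
    simp
  simpa only [heq, one_mul, one_pow, mul_one, finrank_euclideanSpace, Fintype.card_fin] using h

lemma measure_signal_le (ha : IsSensingEnsemble a μ K) (hθ : 0 < θ) (hθ1 : θ ≤ 1)
    (hθK : 12 * θ * (K : ℝ) ^ 2 ≤ 1) (hδ : 0 ≤ δ) (hδ1 : δ ≤ 1)
    (y : EuclideanSpace ℝ (Fin n)) (i : Fin m) :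
    μ.real {ω | ¬ |∑ l, (inner ℝ (a i l ω) y * inner ℝ (a i l ω) y - inner ℝ y y)|
        ≤ δ * p * ‖y‖ ^ 2}
      ≤ 2 * Real.exp (-(θ ^ 2 / 1024 * δ ^ 2 * p)) := by
  -- Homogeneity reduces to the unit ball, with `z = 0` covering `y = 0`. The direction is fixed, so
  -- no net is needed and an exponent of order `δ² p` suffices.
  obtain ⟨z, hz, hyz⟩ : ∃ z : EuclideanSpace ℝ (Fin n), ‖z‖ ≤ 1 ∧ y = ‖y‖ • z := by
    rcases eq_or_ne y 0 with rfl | hy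
    · exact ⟨0, by simp, by simp⟩
    · exact ⟨‖y‖⁻¹ • y, (norm_smul_inv_norm (𝕜 := ℝ) hy).le,
        by rw [smul_smul, mul_inv_cancel₀ (norm_ne_zero_iff.2 hy), one_smul]⟩
  have hw : ∀ j, |(Pi.single i 1 : Fin m → ℝ) j| ≤ 1 := fun j => by
    rcases eq_or_ne j i with rfl | h <;> simp [*]
  have hs : (∑ j, (Pi.single i 1 : Fin m → ℝ) j ^ 2) * p ≤ p := by
    rw [Finset.sum_eq_single i (fun j _ hj => by simp [hj]) (by simp)]
    simp
  refine (measureReal_mono (fun ω hω => ?_) (measure_ne_top _ _)).trans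
    (ha.measure_weighted_le hθ hθ1 hθK hz hz hw hs hδ hδ1)
  change δ * p / 4 ≤ |_|
  rw [Finset.sum_eq_single i (fun j _ hj => by simp [hj]) (by simp)]
  simp only [Pi.single_eq_same, one_mul]
  by_contra hcon
  refine hω ?_
  have h1 : ∑ l, (inner ℝ (a i l ω) y * inner ℝ (a i l ω) y - inner ℝ y y)
      = ‖y‖ ^ 2 * ∑ l, (inner ℝ (a i l ω) z * inner ℝ (a i l ω) z - inner ℝ z z) := by
    rw [Finset.mul_sum]
    refine Finset.sum_congr rfl fun l _ => ?_
    generalize ‖y‖ = c at hyz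
    rw [hyz]
    simp only [inner_smul_right, real_inner_smul_left]
    ring
  rw [h1, abs_mul, abs_of_nonneg (sq_nonneg _), mul_comm]
  refine mul_le_mul_of_nonneg_right ?_ (sq_nonneg _)
  have : 0 ≤ δ * p := by positivity
  linarith

/-- For `‖v‖ ≤ 1` the variance proxy is at most `p`, but the tolerated deviation is `δ √m p`.
Enlarging the proxy to `√m p` keeps the deviation in the range of `bernstein` and produces the
exponent `δ² √m p`. -/
lemma measure_cross_le (ha : IsSensingEnsemble a μ K) (hθ : 0 < θ) (hθ1 : θ ≤ 1)
    (hθK : 12 * θ * (K : ℝ) ^ 2 ≤ 1) (hδ : 0 ≤ δ) (hδ1 : δ ≤ 1) (hm : 0 < m)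
    (y : EuclideanSpace ℝ (Fin n)) :
    μ.real {ω | ¬ ∀ u (v : EuclideanSpace ℝ (Fin m)), |∑ i, ∑ l,
        v i * (inner ℝ (a i l ω) y * inner ℝ (a i l ω) u - inner ℝ y u)|
          ≤ δ * (√m * p) * ‖y‖ * ‖u‖ * ‖v‖}
      ≤ 5 ^ n * 5 ^ m * (2 * Real.exp (-(θ ^ 2 / 1024 * δ ^ 2 * (√m * p)))) := by
  obtain ⟨z, hz, hyz⟩ : ∃ z : EuclideanSpace ℝ (Fin n), ‖z‖ ≤ 1 ∧ y = ‖y‖ • z := by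
    rcases eq_or_ne y 0 with rfl | hy
    · exact ⟨0, by simp, by simp⟩
    · exact ⟨‖y‖⁻¹ • y, (norm_smul_inv_norm (𝕜 := ℝ) hy).le,
        by rw [smul_smul, mul_inv_cancel₀ (norm_ne_zero_iff.2 hy), one_smul]⟩
  have hsm : 1 ≤ √(m : ℝ) := Real.one_le_sqrt.2 (by exact_mod_cast hm)
  have h := measure_bilin_le (μ := μ) (fun ω => crossForm (fun i l => a i l ω) z)
    (r := δ * (√m * p)) (q := 2 * Real.exp (-(θ ^ 2 / 1024 * δ ^ 2 * (√m * p))))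
    (by positivity)
    (fun u v hu hv => ha.measure_weighted_le hθ hθ1 hθK hz hu (w := fun i => v i)
      (fun i => (PiLp.norm_apply_le v i).trans hv) (s := √m * p) (by
        have h1 : ∑ i, v i ^ 2 ≤ 1 := by
          have : ‖v‖ ^ 2 ≤ 1 := pow_le_one₀ (norm_nonneg _) hv
          simpa [EuclideanSpace.norm_sq_eq] using this
        gcongr
        linarith) hδ hδ1)
  simp only [finrank_euclideanSpace, Fintype.card_fin] at h
  refine (measureReal_mono (fun ω hω => ?_) (measure_ne_top _ _)).trans h
  intro hcon
  refine hω fun u v => ?_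
  have h1 : ∑ i, ∑ l, v i * (inner ℝ (a i l ω) y * inner ℝ (a i l ω) u - inner ℝ y u)
      = ‖y‖ * crossForm (fun i l => a i l ω) z u v := by
    rw [crossForm, LinearMap.mk₂_apply, Finset.mul_sum]
    refine Finset.sum_congr rfl fun i _ => ?_
    rw [Finset.mul_sum]
    refine Finset.sum_congr rfl fun l _ => ?_
    generalize ‖y‖ = c at hyz
    rw [hyz]
    simp only [inner_smul_right, real_inner_smul_left]
    ring
  rw [h1, abs_mul, abs_norm]
  calc ‖y‖ * |crossForm (fun i l => a i l ω) z u v|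
      ≤ ‖y‖ * (δ * (√m * p) * ‖u‖ * ‖v‖) := mul_le_mul_of_nonneg_left (hcon u v) (norm_nonneg _)
    _ = _ := by ring

lemma measure_not_wellConditioned_le (ha : IsSensingEnsemble a μ K) (hθ : 0 < θ) (hθ1 : θ ≤ 1)
    (hθK : 12 * θ * (K : ℝ) ^ 2 ≤ 1) (hδ : 0 ≤ δ) (hδ1 : δ ≤ 1) (hm : 0 < m)
    (y : EuclideanSpace ℝ (Fin n)) :
    μ.real {ω | ¬ WellConditioned (fun i l => a i l ω) δ y}
      ≤ 5 ^ n * 5 ^ n * (2 * Real.exp (-(θ ^ 2 / 1024 * δ ^ 2 * (m * p))))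
        + m * (2 * Real.exp (-(θ ^ 2 / 1024 * δ ^ 2 * p)))
        + 5 ^ n * 5 ^ m * (2 * Real.exp (-(θ ^ 2 / 1024 * δ ^ 2 * (√m * p))))
        + m * (5 ^ n * 5 ^ n * (2 * Real.exp (-(θ ^ 2 / 1024 * (m * p))))) := by
  have hsub : {ω | ¬ WellConditioned (fun i l => a i l ω) δ y} ⊆
      (({ω | ¬ ∀ u v, |∑ i, ∑ l,
        (inner ℝ (a i l ω) u * inner ℝ (a i l ω) v - inner ℝ u v)| ≤ δ * (m * p) * ‖u‖ * ‖v‖} ∪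
      ⋃ i : Fin m, {ω | ¬ |∑ l, (inner ℝ (a i l ω) y * inner ℝ (a i l ω) y - inner ℝ y y)|
        ≤ δ * p * ‖y‖ ^ 2}) ∪
      {ω | ¬ ∀ u (v : EuclideanSpace ℝ (Fin m)), |∑ i, ∑ l,
        v i * (inner ℝ (a i l ω) y * inner ℝ (a i l ω) u - inner ℝ y u)|
          ≤ δ * (√m * p) * ‖y‖ * ‖u‖ * ‖v‖}) ∪
      ⋃ i : Fin m, {ω | ¬ ∀ u v, |∑ l,
        (inner ℝ (a i l ω) u * inner ℝ (a i l ω) v - inner ℝ u v)| ≤ m * p * ‖u‖ * ‖v‖} := by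
    intro ω hω
    by_contra hcon
    simp only [Set.mem_union, Set.mem_iUnion, Set.mem_ofPred_eq, not_or, not_exists, not_not]
      at hcon
    exact hω ⟨hcon.1.1.1, hcon.1.1.2, hcon.1.2, hcon.2⟩
  refine (measureReal_mono hsub (measure_ne_top _ _)).trans ?_
  refine (measureReal_union_le _ _).trans (add_le_add ?_ ?_)
  · refine (measureReal_union_le _ _).trans (add_le_add ?_ ?_)
    · refine (measureReal_union_le _ _).trans (add_le_add ?_ ?_)
      · exact ha.measure_covariance_le hθ hθ1 hθK hδ hδ1
      · refine (measureReal_iUnion_fintype_le _).trans ((Finset.sum_le_sum fun i _ =>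
          ha.measure_signal_le hθ hθ1 hθK hδ hδ1 y i).trans (by simp))
    · exact ha.measure_cross_le hθ hθ1 hθK hδ hδ1 hm y
  · exact (measureReal_iUnion_fintype_le _).trans ((Finset.sum_le_sum fun i _ =>
      ha.measure_covariance_row_le hθ hθ1 hθK i).trans (by simp))

end IsSensingEnsemble

/-! ### Absorbing the net cardinalities and assembling the probability bound -/

lemma five_pow_mul_exp_neg_le {k j : ℕ} {c s : ℝ} (h : 4 * ((k : ℝ) + j) ≤ c / 2 * s) :
    5 ^ k * 5 ^ j * (2 * Real.exp (-(c * s))) ≤ 2 * Real.exp (-(c / 2) * s) := by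
  have h5 : (5 : ℝ) ≤ Real.exp 4 := by linarith [Real.add_one_le_exp (4 : ℝ)]
  have h1 : (5 : ℝ) ^ k * 5 ^ j ≤ Real.exp (4 * (k + j)) := by
    rw [← pow_add, mul_comm, ← Nat.cast_add, Real.exp_nat_mul]
    exact pow_le_pow_left₀ (by norm_num) h5 _
  calc 5 ^ k * 5 ^ j * (2 * Real.exp (-(c * s)))
      ≤ Real.exp (4 * (k + j)) * (2 * Real.exp (-(c * s))) := by gcongr
    _ = 2 * Real.exp (4 * (k + j) + -(c * s)) := by rw [Real.exp_add]; ring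
    _ ≤ 2 * Real.exp (-(c / 2) * s) := by
        gcongr
        linarith

end BlindCalibration

theorem proposition2 (K : ℝ≥0) :
    ∃ C₀ > (0 : ℝ), ∃ C > (0 : ℝ), ∃ c > (0 : ℝ),
      ∀ (n m p : ℕ), 0 < n → 0 < m → 0 < p →
      ∀ (δ t ρ κ : ℝ), 0 < δ → δ < 1 → 1 ≤ t → 0 ≤ ρ → ρ < (1 - 2 * δ) / 9 → 0 ≤ κ →
      (n : ℝ) ≥ C₀ * (t * Real.log ((m : ℝ) * p)) →
      (p : ℝ) ≥ C₀ * (δ⁻¹ ^ 2 * Real.log m) →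
      √(m : ℝ) * p ≥ C₀ * (δ⁻¹ ^ 2 * ((n : ℝ) + m) * Real.log (n / δ)) →
      ∀ (Ω : Type*) [MeasurableSpace Ω] (μ : Measure Ω) [IsProbabilityMeasure μ]
        (a : Fin m → Fin p → Ω → EuclideanSpace ℝ (Fin n)),
      BlindCalibration.IsSensingEnsemble a μ K →
      ∀ (x : EuclideanSpace ℝ (Fin n)) (d : EuclideanSpace ℝ (Fin m)),
      (∀ i, 0 < d i) → BlindCalibration.dStar d ∈ BlindCalibration.gainSet m ρ →
      μ.real {ω | ∀ z ∈ BlindCalibration.nbhd x d κ ρ,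
          BlindCalibration.BoundedCurvature
            (BlindCalibration.sensingMatrix fun i l => a i l ω) x d
            (2 * (1 - 9 * ρ - 2 * δ)) z.1 z.2 ∧
          BlindCalibration.LipschitzGradient
            (BlindCalibration.sensingMatrix fun i l => a i l ω) x d
            (4 * √2 * (1 + ρ + (1 + κ) * ‖BlindCalibration.xStar x d‖)) z.1 z.2} >
        1 - C * ((m : ℝ) * Real.exp (-c * δ ^ 2 * p)
          + Real.exp (-c * δ ^ 2 * √(m : ℝ) * p)
          + Real.exp (-c * δ ^ 2 * m * p)
          + ((m : ℝ) * p) ^ (-t)) := by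
  obtain ⟨θ, hθ, hθ1, hθK⟩ : ∃ θ : ℝ, 0 < θ ∧ θ ≤ 1 ∧ 12 * θ * (K : ℝ) ^ 2 ≤ 1 := by
    refine ⟨1 / (12 * ((K : ℝ) ^ 2 + 1)), by positivity, ?_, ?_⟩
    · rw [div_le_one (by positivity)]
      nlinarith [sq_nonneg (K : ℝ)]
    · rw [mul_one_div, div_mul_eq_mul_div, div_le_one (by positivity)]
      linarith
  obtain ⟨c, hc⟩ : ∃ c, c = θ ^ 2 / 1024 := ⟨_, rfl⟩
  have hc0 : 0 < c := by rw [hc]; positivity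
  -- Half of the Bernstein rate `c` pays for the nets. With `log(n/δ) ≥ 1/2`, the factor 32 gives
  -- `8(n+m) ≤ (c/2) δ² √m p`, enough for the pairs `(n,n)` and `(n,m)`. The term `m exp(-(c/2) δ²
  -- p)` collects coefficient 4, two from `signal` and two from `covariance_row`; 5 leaves room for
  -- strictness.
  refine ⟨32 / c, by positivity, 5, by norm_num, c / 2, by positivity, ?_⟩
  intro n m p hn hm hp δ t ρ κ hδ hδ1 _ hρ hρδ hκ _ _ hsize Ω _ μ _ a ha x d hd hdρ
  have hn1 : (1 : ℝ) ≤ n := by exact_mod_cast hn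
  have hm1 : (1 : ℝ) ≤ m := by exact_mod_cast hm
  have hsm : √(m : ℝ) ≤ m := Real.sqrt_le_iff.2 ⟨by positivity, by nlinarith⟩
  have hlog : 1 / 2 ≤ Real.log (n / δ) := by
    -- The condition `0 ≤ ρ < (1-2δ)/9` forces `δ < 1/2`.
    have h1 : (2 : ℝ) ≤ n / δ := by
      rw [le_div_iff₀ hδ]
      linarith
    have h2 := Real.log_le_log two_pos h1
    linarith [Real.log_two_gt_d9]
  have hdim : 4 * ((n : ℝ) + n) ≤ c / 2 * (δ ^ 2 * (√m * p)) ∧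
      4 * ((n : ℝ) + m) ≤ c / 2 * (δ ^ 2 * (√m * p)) := by
    have h1 : 32 / c * (δ⁻¹ ^ 2 * ((n : ℝ) + m) * (1 / 2)) ≤ √m * p :=
      le_trans (by gcongr) hsize
    have h2 := mul_le_mul_of_nonneg_left h1 (show 0 ≤ c / 2 * δ ^ 2 by positivity)
    have h3 : c / 2 * δ ^ 2 * (32 / c * (δ⁻¹ ^ 2 * ((n : ℝ) + m) * (1 / 2)))
        = 8 * ((n : ℝ) + m) := by
      field_simp
      norm_num
    rw [h3] at h2
    constructor <;> linarith
  have hδ2 : δ ^ 2 ≤ 1 := pow_le_one₀ hδ.le hδ1.le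
  have hs1 : δ ^ 2 * (√m * p) ≤ δ ^ 2 * (m * p) := by gcongr
  have hs2 : δ ^ 2 * (m * p) ≤ 1 * (m * p) := by gcongr
  have hs3 : δ ^ 2 * p ≤ m * p := by gcongr; linarith
  have hbad := ha.measure_not_wellConditioned_le hθ hθ1 hθK hδ.le hδ1.le hm
    (BlindCalibration.xStar x d)
  simp only [← hc, mul_assoc c] at hbad
  have b1 := BlindCalibration.five_pow_mul_exp_neg_le (k := n) (j := n) (c := c)
    (s := δ ^ 2 * (m * p)) (hdim.1.trans (by gcongr))
  have b3 := BlindCalibration.five_pow_mul_exp_neg_le (k := n) (j := m) (c := c)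
    (s := δ ^ 2 * (√m * p)) hdim.2
  have b4 := BlindCalibration.five_pow_mul_exp_neg_le (k := n) (j := n) (c := c)
    (s := m * p) (hdim.1.trans (mul_le_mul_of_nonneg_left (by linarith) (by positivity)))
  have b2 : 2 * Real.exp (-(c * (δ ^ 2 * p))) ≤ 2 * Real.exp (-(c / 2) * (δ ^ 2 * p)) := by
    have : 0 ≤ c * (δ ^ 2 * p) := by positivity
    gcongr
    linarith
  -- The row events come with a factor `m`, so their tail is weakened to match the one term of the
  -- target carrying that factor.
  have b5 : 2 * Real.exp (-(c / 2) * (m * p)) ≤ 2 * Real.exp (-(c / 2) * (δ ^ 2 * p)) := by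
    have := mul_le_mul_of_nonneg_left hs3 hc0.le
    gcongr 2 * Real.exp ?_
    linarith
  have b2' := mul_le_mul_of_nonneg_left b2 (Nat.cast_nonneg (α := ℝ) m)
  have b4' := mul_le_mul_of_nonneg_left (b4.trans b5) (Nat.cast_nonneg (α := ℝ) m)
  set G := {ω | ∀ z ∈ BlindCalibration.nbhd x d κ ρ,
    BlindCalibration.BoundedCurvature (BlindCalibration.sensingMatrix fun i l => a i l ω) x d
      (2 * (1 - 9 * ρ - 2 * δ)) z.1 z.2 ∧
    BlindCalibration.LipschitzGradient (BlindCalibration.sensingMatrix fun i l => a i l ω) x d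
      (4 * √2 * (1 + ρ + (1 + κ) * ‖BlindCalibration.xStar x d‖)) z.1 z.2} with hG
  -- Covering the whole space uses only subadditivity, so measurability of `G`, an intersection over
  -- all `z`, is not needed.
  have hcover : Set.univ ⊆ G ∪ {ω | ¬ BlindCalibration.WellConditioned (fun i l => a i l ω) δ
      (BlindCalibration.xStar x d)} := by
    intro ω _
    by_cases hω : BlindCalibration.WellConditioned (fun i l => a i l ω) δ
      (BlindCalibration.xStar x d)
    · exact Or.inl fun z hz =>
        ⟨hω.boundedCurvature hm hp hd hdρ hz.1 hρ hδ.le (by linarith),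
          hω.lipschitzGradient hm hp hd hz hκ hρ hδ.le (by linarith)⟩
    · exact Or.inr hω
  have htotal := (measureReal_mono hcover (measure_ne_top μ _)).trans (measureReal_union_le _ _)
  rw [probReal_univ] at htotal
  have hpos : 0 < ((m : ℝ) * p) ^ (-t) := Real.rpow_pos_of_pos (by positivity) _
  have e1 : -(c / 2) * δ ^ 2 * p = -(c / 2) * (δ ^ 2 * p) := by ring
  have e2 : -(c / 2) * δ ^ 2 * √m * p = -(c / 2) * (δ ^ 2 * (√m * p)) := by ring
  have e3 : -(c / 2) * δ ^ 2 * m * p = -(c / 2) * (δ ^ 2 * (m * p)) := by ring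
  rw [e1, e2, e3]
  have p1 := Real.exp_pos (-(c / 2) * (δ ^ 2 * (√m * p)))
  have p2 := Real.exp_pos (-(c / 2) * (δ ^ 2 * (m * p)))
  have p3 : 0 < (m : ℝ) * Real.exp (-(c / 2) * (δ ^ 2 * p)) := by positivity
  linarith
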